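/- Let $n\ge 1$ and $f\in\mathcal S(\mathbb R^{2n})$ (complex-valued), write points of $\mathbb R^{2n}$ as $(x,y)$ with $x,y\in\mathbb R^n$, and let $\widehat f(\xi,\eta)=\int_{\mathbb R^n\times\mathbb R^n} e^{2\pi i(x\cdot\xi+y\cdot\eta)}f(x,y)\,dx\,dy$. (a) For $0<\lambda<n$, both integrals below are finite and $$\int_{\mathbb R^n\times\mathbb R^n}|x-y|^{-\lambda}|f(x,y)|^2\,dx\,dy\le F_\lambda\int_{\mathbb R^n\times\mathbb R^n}|\xi-\eta|^{\lambda}|\widehat f(\xi,\eta)|^2\,d\xi\,d\eta,\qquad F_\lambda=\Big(\frac{\pi}{2}\Big)^{\lambda}\left[\frac{\Gamma(\frac{n-\lambda}{4})}{\Gamma(\frac{n+\lambda}{4})}\right]^2 .$$ (b) For $0<\lambda<\min(2,n)$, $$\int_{\mathbb R^n\times\mathbb R^n}|x-y|^{-\lambda}|f(x,y)|^2\,dx\,dy\le G_\lambda\int_{\mathbb R^{2n}}\int_{\{(u,v)\in\mathbb R^{2n}:\,u+v=x+y\}}|x-y-u+v|^{-n-\lambda}\,|f(x,y)-f(u,v)|^2\,d\sigma(u,v)\,dx\,dy,$$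 $$G_\lambda=\Big(\frac{\pi}{2}\Big)^{-n/2}\,\frac{\lambda}{4}\,\frac{\Gamma(\frac{n+\lambda}{2})}{\Gamma(1-\frac{\lambda}{2})}\left[\frac{\Gamma(\frac{n-\lambda}{4})}{\Gamma(\frac{n+\lambda}{4})}\right]^2,$$ where $\sigma$ is $n$-dimensional Lebesgue measure on the $n$-plane $u+v=x+y$, that is, $(u,v)=(x+s/\sqrt2,\;y-s/\sqrt2)$ with $d\sigma=ds$, $s\in\mathbb R^n$; the right-hand side is finite. The inequality also holds, in $[0,\infty]$, with the integral on the right replaced by $\int_{\mathbb R^{2n}\times\mathbb R^{2n}}|x-y-u+v|^{-n-\lambda}|f(x,y)-f(u,v)|^2\,dx\,dy\,du\,dv$. (c) (Logarithmic uncertainty) The integrals below converge absolutely and $$\int_{\mathbb R^n\times\mathbb R^n}\ln|x-y|\,|f(x,y)|^2\,dx\,dy+\int_{\mathbb R^n\times\mathbb R^n}\ln|\xi-\eta|\,|\widehat f(\xi,\eta)|^2\,d\xi\,d\eta\ \ge\ \Big[\psi\Big(\frac n4\Big)-\ln\frac{\pi}{2}\Big]\int_{\mathbb R^n\times\mathbb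 R^n}|f(x,y)|^2\,dx\,dy,\qquad \psi=(\ln\Gamma)'.$$ -/

import Mathlib

open MeasureTheory
open scoped SchwartzMap

namespace PittAS

noncomputable section

/-- Euclidean `n`-space. -/
abbrev E (n : ℕ) : Type := EuclideanSpace ℝ (Fin n)

/-- The Fourier transform on `ℝⁿ × ℝⁿ`, with the convention
`f̂(ξ, η) = ∫ exp(2πi (x·ξ + y·η)) f(x, y) dx dy`. -/
def fourier {n : ℕ} (f : E n × E n → ℂ) (w : E n × E n) : ℂ :=
  ∫ z : E n × E n,
    Complex.exp (2 * Real.pi * Complex.I *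
      ((inner ℝ z.1 w.1 + inner ℝ z.2 w.2 : ℝ) : ℂ)) * f z

/-- `|x - y|^(-lam) |f(x, y)|²`. -/
def potentialDensity {n : ℕ} (lam : ℝ) (f : E n × E n → ℂ) (z : E n × E n) : ℝ :=
  ‖z.1 - z.2‖ ^ (-lam) * ‖f z‖ ^ 2

/-- `|ξ - η|^lam |f̂(ξ, η)|²`. -/
def frequencyDensity {n : ℕ} (lam : ℝ) (f : E n × E n → ℂ) (w : E n × E n) : ℝ :=
  ‖w.1 - w.2‖ ^ lam * ‖fourier f w‖ ^ 2

/-- For `z = (x, y)` and `z' = (u, v)`: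
`|x - y - u + v|^(-n-lam) |f(x, y) - f(u, v)|²`. -/
def differenceDensity {n : ℕ} (lam : ℝ) (f : E n × E n → ℂ) (z z' : E n × E n) : ℝ :=
  ‖z.1 - z.2 - z'.1 + z'.2‖ ^ (-(n : ℝ) - lam) * ‖f z - f z'‖ ^ 2

/-- The isometric parametrization `s ↦ (x + s/√2, y - s/√2)`, `s ∈ ℝⁿ`, of the `n`-plane
`{(u, v) : u + v = x + y}` through `z = (x, y)`; it carries Lebesgue measure on `ℝⁿ` to the
`n`-dimensional Euclidean surface measure of that plane. -/
def planePoint {n : ℕ} (z : E n × E n) (s : E n) : E n × E n :=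
  (z.1 + (Real.sqrt 2)⁻¹ • s, z.2 - (Real.sqrt 2)⁻¹ • s)

/-- `F_lam = (π/2)^lam [Γ((n-lam)/4) / Γ((n+lam)/4)]²`. -/
def constF (n : ℕ) (lam : ℝ) : ℝ :=
  (Real.pi / 2) ^ lam * (Real.Gamma ((n - lam) / 4) / Real.Gamma ((n + lam) / 4)) ^ 2

/-- `G_lam = (π/2)^(-n/2) (lam/4) Γ((n+lam)/2) / Γ(1-lam/2) [Γ((n-lam)/4) / Γ((n+lam)/4)]²`. -/
def constG (n : ℕ) (lam : ℝ) : ℝ :=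
  (Real.pi / 2) ^ (-(n : ℝ) / 2) * (lam / 4) *
    (Real.Gamma ((n + lam) / 2) / Real.Gamma (1 - lam / 2)) *
    (Real.Gamma ((n - lam) / 4) / Real.Gamma ((n + lam) / 4)) ^ 2

/-- The digamma function `ψ = (ln Γ)'` (used on positive reals). -/
def psi (t : ℝ) : ℝ := deriv (fun r : ℝ => Real.log (Real.Gamma r)) t

end

end PittAS

/-! Let `T : V → W` be linear with `T T† = κ`. The power `‖T x‖ ^ (-λ)` is a superposition of the
Gaussians `exp (-π t ‖T x‖ ^ 2)` under a Riemann–Liouville measure in `t`. By Plancherel, pairing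
such a Gaussian with `‖f‖ ^ 2` averages `⟪𝓕 f w, 𝓕 f (w + T† ζ)⟫` over `w` and, with a heat kernel
as weight, over `ζ`; hence `∫ ‖T x‖ ^ (-λ) * ‖f x‖ ^ 2` is a quadratic form of `𝓕 f` whose kernel
is the Riesz kernel of order `λ` along the range of `T†`. Schur's test with a power of `‖T w‖` as
test function bounds this form, and the semigroup law of the Riesz kernels evaluates the resulting
constant, which is the sharp one.

Plancherel applied to `f - f (· + T† s)` turns the difference functional into a constant times
`∫ ‖T w‖ ^ λ * ‖𝓕 f w‖ ^ 2`. The functional over all pairs of points is infinite unless `f = 0`,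
because its kernel does not decay along `ker T`. Pitt's inequality is an equality at `λ = 0`;
comparing the derivatives of its two sides there gives the logarithmic inequality.

The theorem is the case `T (x, y) = x - y`, for which `κ = 2`. -/

namespace PittAS

open Set ENNReal Filter Topology InnerProductSpace
open scoped FourierTransform InnerProduct

noncomputable section

lemma lintegral_ofReal_eq_of_integral_eq {α : Type*} [MeasurableSpace α] {μ : Measure α}
    {f : α → ℝ} {c : ℝ} (hf : 0 ≤ᵐ[μ] f) (h : ∫ x, f x ∂μ = c) (hc : c ≠ 0) :
    ∫⁻ x, ENNReal.ofReal (f x) ∂μ = ENNReal.ofReal c := by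
  rw [← h, ofReal_integral_eq_lintegral_ofReal (.of_integral_ne_zero (h ▸ hc)) hf]

/-- The density of the Riemann–Liouville measure `liouville a`. -/
def liouvillePDF (a t : ℝ) : ℝ≥0∞ :=
  if 0 < t then ENNReal.ofReal (t ^ (a - 1) / Real.Gamma a) else 0

/-- The Riemann–Liouville measure `t₊ ^ (a - 1) / Γ(a) dt`, normalized so that it has Laplace
transform `r ^ (-a)` and is a convolution semigroup in `a > 0`. -/
def liouville (a : ℝ) : Measure ℝ := volume.withDensity (liouvillePDF a)

@[fun_prop]
lemma measurable_liouvillePDF (a : ℝ) : Measurable (liouvillePDF a) :=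
  Measurable.ite measurableSet_Ioi (by fun_prop) measurable_const

instance (a : ℝ) : SFinite (liouville a) := inferInstanceAs (SFinite (volume.withDensity _))

lemma ae_liouville_pos (a : ℝ) : ∀ᵐ t ∂liouville a, 0 < t := by
  rw [liouville, ae_withDensity_iff (measurable_liouvillePDF a)]
  exact .of_forall fun t ht => not_le.1 fun h => ht (if_neg h.not_gt)

lemma lintegral_liouville (a : ℝ) (g : ℝ → ℝ≥0∞) :
    ∫⁻ t, g t ∂liouville a =
      ∫⁻ t in Ioi (0 : ℝ), ENNReal.ofReal (t ^ (a - 1) / Real.Gamma a) * g t := by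
  rw [liouville, lintegral_withDensity_eq_lintegral_mul_non_measurable _
    (measurable_liouvillePDF a) (.of_forall fun t => by rw [liouvillePDF]; split_ifs <;> simp),
    ← lintegral_indicator measurableSet_Ioi]
  congr 1 with t
  by_cases ht : 0 < t <;> simp [liouvillePDF, ht]

lemma lintegral_liouville_ofReal {a : ℝ} (ha : 0 < a) {g : ℝ → ℝ} {c : ℝ}
    (hg : ∀ t, 0 < t → 0 ≤ g t) (hc : 0 < c)
    (h : ∫ t in Ioi (0 : ℝ), t ^ (a - 1) * g t = c) :
    ∫⁻ t, ENNReal.ofReal (g t) ∂liouville a = ENNReal.ofReal (c / Real.Gamma a) := by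
  have := Real.Gamma_pos_of_pos ha
  rw [lintegral_liouville, ← lintegral_ofReal_eq_of_integral_eq (μ := volume.restrict (Ioi 0))
    (f := fun t => t ^ (a - 1) * g t / Real.Gamma a) _ (by rw [integral_div, h]) (by positivity)]
  · refine setLIntegral_congr_fun measurableSet_Ioi fun t (ht : 0 < t) => ?_
    rw [← ENNReal.ofReal_mul (by positivity), div_mul_eq_mul_div]
  · filter_upwards [ae_restrict_mem measurableSet_Ioi] with t (ht : 0 < t)
    have := hg t ht
    simp only [Pi.zero_apply]
    positivity

lemma lintegral_exp_neg_mul_liouville {a r : ℝ} (ha : 0 < a) (hr : 0 < r) :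
    ∫⁻ t, ENNReal.ofReal (Real.exp (-(r * t))) ∂liouville a = ENNReal.ofReal (r ^ (-a)) := by
  have := Real.Gamma_pos_of_pos ha
  rw [lintegral_liouville_ofReal ha (fun t _ => by positivity) (by positivity)
    (Real.integral_rpow_mul_exp_neg_mul_Ioi ha hr), mul_div_cancel_right₀ _ this.ne', one_div,
    Real.inv_rpow hr.le, Real.rpow_neg hr.le]

lemma lintegral_rpow_mul_exp_neg_div_liouville {a b r : ℝ} (ha : 0 < a) (hab : a < b)
    (hr : 0 < r) :
    ∫⁻ t, ENNReal.ofReal (t ^ (-b) * Real.exp (-(r / t))) ∂liouville a =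
      ENNReal.ofReal (Real.Gamma (b - a) / Real.Gamma a * r ^ (a - b)) := by
  have := Real.Gamma_pos_of_pos (sub_pos.2 hab)
  have hinv : ∫ t in Ioi (0 : ℝ), t ^ (a - 1) * (t ^ (-b) * Real.exp (-(r / t))) =
      r ^ (a - b) * Real.Gamma (b - a) := by
    rw [← neg_sub b a, Real.rpow_neg hr.le, ← Real.inv_rpow hr.le, ← one_div,
      ← Real.integral_rpow_mul_exp_neg_mul_Ioi (sub_pos.2 hab) hr,
      ← integral_comp_rpow_Ioi _ (neg_ne_zero.2 one_ne_zero)]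
    refine setIntegral_congr_fun measurableSet_Ioi fun t (ht : 0 < t) => ?_
    have hpow : t ^ (-1 - 1 : ℝ) * ((t⁻¹) ^ (a - 1) * (t⁻¹) ^ (-b)) = t ^ (b - a - 1) := by
      rw [Real.inv_rpow ht.le, Real.inv_rpow ht.le, ← Real.rpow_neg ht.le, ← Real.rpow_neg ht.le,
        ← Real.rpow_add ht, ← Real.rpow_add ht]
      ring_nf
    rw [← hpow, Real.rpow_neg_one, abs_neg, abs_one, smul_eq_mul, div_inv_eq_mul]
    ring
  rw [lintegral_liouville_ofReal ha (fun t ht => by positivity) (by positivity) hinv]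
  congr 1
  ring

lemma ofReal_one_sub_exp_neg_div {r t : ℝ} (hr : 0 ≤ r) (ht : 0 < t) :
    ENNReal.ofReal (1 - Real.exp (-(r / t))) =
      ∫⁻ ρ in Ioc 0 r, ENNReal.ofReal (t⁻¹ * Real.exp (-(ρ / t))) := by
  have hderiv (ρ : ℝ) : HasDerivAt (fun ρ => -Real.exp (-(ρ / t)))
      (t⁻¹ * Real.exp (-(ρ / t))) ρ :=
    ((hasDerivAt_id' ρ).div_const t).fun_neg.exp.fun_neg.congr_deriv (by ring)
  rw [← ofReal_integral_eq_lintegral_ofReal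
    (Continuous.integrableOn_Ioc (by fun_prop)) (.of_forall fun ρ => by positivity),
    ← intervalIntegral.integral_of_le hr, intervalIntegral.integral_eq_sub_of_hasDerivAt
      (fun ρ _ => hderiv ρ) (Continuous.intervalIntegrable (by fun_prop) _ _)]
  simp only [zero_div, neg_zero, Real.exp_zero, sub_neg_eq_add]
  ring_nf

lemma lintegral_rpow_mul_one_sub_exp_liouville {a b r : ℝ} (ha : 0 < a) (hba : b < a)
    (hab : a < b + 1) (hr : 0 < r) :
    ∫⁻ t, ENNReal.ofReal (t ^ (-b) * (1 - Real.exp (-(r / t)))) ∂liouville a =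
      ENNReal.ofReal (Real.Gamma (b + 1 - a) / (Real.Gamma a * (a - b)) * r ^ (a - b)) := by
  calc ∫⁻ t, ENNReal.ofReal (t ^ (-b) * (1 - Real.exp (-(r / t)))) ∂liouville a
      = ∫⁻ t, (∫⁻ ρ in Ioc 0 r,
          ENNReal.ofReal (t ^ (-(b + 1)) * Real.exp (-(ρ / t)))) ∂liouville a := by
        refine lintegral_congr_ae ?_
        filter_upwards [ae_liouville_pos a] with t ht
        rw [ENNReal.ofReal_mul (by positivity), ofReal_one_sub_exp_neg_div hr.le ht,
          ← lintegral_const_mul' _ _ ofReal_ne_top]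
        refine lintegral_congr fun ρ => ?_
        rw [← ENNReal.ofReal_mul (by positivity), ← mul_assoc, neg_add, Real.rpow_add ht,
          Real.rpow_neg_one]
    _ = ∫⁻ ρ in Ioc 0 r,
          ENNReal.ofReal (Real.Gamma (b + 1 - a) / Real.Gamma a * ρ ^ (a - b - 1)) := by
        rw [lintegral_lintegral_swap (by fun_prop)]
        refine setLIntegral_congr_fun measurableSet_Ioc fun ρ hρ => ?_
        simp only [lintegral_rpow_mul_exp_neg_div_liouville ha hab hρ.1, sub_add_eq_sub_sub]
    _ = _ := by
        have := Real.Gamma_pos_of_pos ha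
        have hΓ' := Real.Gamma_pos_of_pos (sub_pos.2 hab)
        rw [← ofReal_integral_eq_lintegral_ofReal
          ((intervalIntegral.intervalIntegrable_rpow' (by linarith)).1.const_mul _),
          integral_const_mul, ← intervalIntegral.integral_of_le hr.le, integral_rpow
            (.inl (by linarith)), sub_add_cancel, Real.zero_rpow (sub_pos.2 hba).ne', sub_zero]
        · congr 1
          field_simp
        · filter_upwards [ae_restrict_mem measurableSet_Ioc] with ρ hρ
          have := hρ.1
          simp only [Pi.zero_apply]
          positivity

lemma liouvillePDF_mul_liouvillePDF_one_sub {a b : ℝ} (ha : 0 < a) (hb : 0 < b) (u : ℝ) :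
    liouvillePDF a u * liouvillePDF b (1 - u) =
      ENNReal.ofReal (Real.Gamma (a + b))⁻¹ * ProbabilityTheory.betaPDF a b u := by
  have := Real.Gamma_pos_of_pos ha
  have := Real.Gamma_pos_of_pos hb
  have := Real.Gamma_pos_of_pos (add_pos ha hb)
  by_cases hu : 0 < u ∧ u < 1
  · obtain ⟨h0, h1⟩ := hu
    rw [liouvillePDF, liouvillePDF, if_pos h0, if_pos (sub_pos.2 h1),
      ProbabilityTheory.betaPDF_of_pos_lt_one h0 h1, ← ENNReal.ofReal_mul (by positivity),
      ← ENNReal.ofReal_mul (by positivity), ProbabilityTheory.beta]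
    congr 1
    field_simp
  · rw [ProbabilityTheory.betaPDF_eq, if_neg hu, ofReal_zero, mul_zero, mul_eq_zero,
      liouvillePDF, liouvillePDF]
    simp only [sub_pos, ite_eq_right_iff]
    tauto

lemma liouvillePDF_mul {t : ℝ} (ht : 0 < t) (a s : ℝ) :
    liouvillePDF a (t * s) = ENNReal.ofReal (t ^ (a - 1)) * liouvillePDF a s := by
  simp only [liouvillePDF, mul_pos_iff_of_pos_left ht]
  split_ifs with hs
  · rw [← ENNReal.ofReal_mul (by positivity), Real.mul_rpow ht.le hs.le, mul_div_assoc]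
  · simp

@[fun_prop]
lemma measurable_betaPDF (a b : ℝ) : Measurable (ProbabilityTheory.betaPDF a b) :=
  (ProbabilityTheory.measurable_betaPDFReal a b).ennreal_ofReal

lemma lconvolution_liouvillePDF {a b : ℝ} (ha : 0 < a) (hb : 0 < b) :
    liouvillePDF a ⋆ₗ liouvillePDF b = liouvillePDF (a + b) := by
  ext t
  rw [lconvolution_def]
  by_cases ht : 0 < t
  · have hscale (s : ℝ) : liouvillePDF a s * liouvillePDF b (-s + t) =
        ENNReal.ofReal (t ^ (a - 1) * t ^ (b - 1) * (Real.Gamma (a + b))⁻¹) *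
          ProbabilityTheory.betaPDF a b (t⁻¹ * s) := by
      have hs : s = t * (t⁻¹ * s) := by simp [ht.ne']
      have hst : -s + t = t * (1 - t⁻¹ * s) := by simp [mul_sub, ht.ne']; ring
      rw [hst, liouvillePDF_mul ht]
      nth_rw 1 [hs]
      rw [liouvillePDF_mul ht, mul_mul_mul_comm, liouvillePDF_mul_liouvillePDF_one_sub ha hb,
        ← mul_assoc, ← ENNReal.ofReal_mul (by positivity), ← ENNReal.ofReal_mul (by positivity)]
    have := Real.Gamma_pos_of_pos (add_pos ha hb)
    have hbeta : ∫⁻ s, ProbabilityTheory.betaPDF a b (t⁻¹ * s) = ENNReal.ofReal t := by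
      rw [← Real.smul_map_volume_mul_left ht.ne', lintegral_smul_measure,
        lintegral_map (by fun_prop) (by fun_prop)]
      simp [ht.ne', abs_of_pos ht, ProbabilityTheory.lintegral_betaPDF_eq_one ha hb]
    simp only [hscale]
    rw [lintegral_const_mul' _ _ ofReal_ne_top, hbeta, liouvillePDF, if_pos ht,
      ← ENNReal.ofReal_mul (by positivity), ← Real.rpow_add ht, mul_right_comm,
      ← Real.rpow_add_one ht.ne', div_eq_mul_inv]
    ring_nf
  · rw [liouvillePDF, if_neg ht]
    refine (lintegral_congr fun s => ?_).trans lintegral_zero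
    by_cases hs : 0 < s
    · rw [liouvillePDF, liouvillePDF, if_neg (show ¬ 0 < -s + t by linarith), mul_zero]
    · rw [liouvillePDF, if_neg hs, zero_mul]

lemma liouville_conv_liouville {a b : ℝ} (ha : 0 < a) (hb : 0 < b) :
    liouville a ∗ liouville b = liouville (a + b) := by
  rw [liouville, liouville, conv_withDensity_eq_lconvolution (by fun_prop) (by fun_prop),
    lconvolution_liouvillePDF ha hb, liouville]

section HeatKernel

variable {W : Type*} [NormedAddCommGroup W] [InnerProductSpace ℝ W]

/-- The Gaussian `t ^ (-m / 2) exp (-π ‖v‖² / t)` of total mass one, `m = dim W`: the heat kernel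
in the time scale for which its Fourier transform is `exp (-π t ‖w‖²)`. -/
def heat (t : ℝ) (v : W) : ℝ :=
  t ^ (-(Module.finrank ℝ W / 2 : ℝ)) * Real.exp (-(Real.pi * ‖v‖ ^ 2 / t))

/-- The Riesz kernel, the superposition of heat kernels under the Riemann–Liouville measure. It is
proportional to `‖v‖ ^ (2 * α - dim W)`, and normalized so that it is a convolution semigroup. -/
def riesz (α : ℝ) (v : W) : ℝ≥0∞ := ∫⁻ t, ENNReal.ofReal (heat t v) ∂liouville α

lemma heat_nonneg {t : ℝ} (ht : 0 < t) (v : W) : 0 ≤ heat t v := by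
  unfold heat
  positivity

lemma heat_neg (t : ℝ) (v : W) : heat t (-v) = heat t v := by
  simp only [heat, norm_neg]

lemma riesz_neg (α : ℝ) (v : W) : riesz α (-v) = riesz α v := by
  simp only [riesz, heat_neg]

lemma riesz_eq {α : ℝ} (hα : 0 < α) (hαm : α < Module.finrank ℝ W / 2) {v : W} (hv : v ≠ 0) :
    riesz α v = ENNReal.ofReal (Real.Gamma (Module.finrank ℝ W / 2 - α) / Real.Gamma α *
      (Real.pi * ‖v‖ ^ 2) ^ (α - Module.finrank ℝ W / 2)) :=
  lintegral_rpow_mul_exp_neg_div_liouville hα hαm (by positivity)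

lemma heat_mul_heat {s t : ℝ} (hs : 0 < s) (ht : 0 < t) (v x : W) :
    heat s v * heat t (-v + x) =
      heat (s + t) x * heat (s * t / (s + t)) (v - (s / (s + t)) • x) := by
  have hst : 0 < s + t := add_pos hs ht
  have hsq : ‖v‖ ^ 2 / s + ‖-v + x‖ ^ 2 / t =
      ‖x‖ ^ 2 / (s + t) + ‖v - (s / (s + t)) • x‖ ^ 2 / (s * t / (s + t)) := by
    rw [neg_add_eq_sub, norm_sub_sq_real, norm_sub_sq_real, real_inner_comm, real_inner_smul_right,
      norm_smul, Real.norm_of_nonneg (by positivity)]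
    field_simp
    ring
  unfold heat
  rw [mul_mul_mul_comm, mul_mul_mul_comm ((s + t) ^ _), ← Real.mul_rpow hs.le ht.le,
    ← Real.mul_rpow hst.le (by positivity), mul_div_cancel₀ _ hst.ne', ← Real.exp_add,
    ← Real.exp_add]
  congr 2
  simp only [mul_div_assoc, ← neg_add, ← mul_add, hsq]

variable [MeasurableSpace W] [BorelSpace W]

@[fun_prop]
lemma measurable_heat : Measurable fun p : ℝ × W => heat p.1 p.2 := by
  unfold heat
  fun_prop

@[fun_prop]
lemma measurable_riesz (α : ℝ) : Measurable (riesz α : W → ℝ≥0∞) := by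
  unfold riesz
  exact Measurable.lintegral_prod_left'
    (f := fun p : ℝ × W => ENNReal.ofReal (heat p.1 p.2)) (by fun_prop)

variable [FiniteDimensional ℝ W]

lemma fourier_heat {t : ℝ} (ht : 0 < t) (w : W) :
    𝓕 (fun v : W => (heat t v : ℂ)) w = Real.exp (-(Real.pi * t * ‖w‖ ^ 2)) := by
  have hpow : ((Real.pi / (Real.pi / t : ℝ) : ℂ)) ^ (Module.finrank ℝ W / 2 : ℂ) =
      (t ^ (Module.finrank ℝ W / 2 : ℝ) : ℝ) := by
    rw [← Complex.ofReal_div, div_div_cancel₀ Real.pi_ne_zero, Complex.ofReal_cpow ht.le]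
    push_cast
    rfl
  have hgauss := fourier_gaussian_innerProductSpace (V := W) (b := (Real.pi / t : ℝ))
    (by rw [Complex.ofReal_re]; positivity) w
  rw [Real.fourier_eq, hpow] at hgauss
  rw [Real.fourier_eq]
  calc ∫ v : W, Real.fourierChar (-⟪v, w⟫_ℝ) • (heat t v : ℂ)
      = ∫ v : W, (t ^ (-(Module.finrank ℝ W / 2 : ℝ)) : ℝ) •
          (Real.fourierChar (-⟪v, w⟫_ℝ) • Complex.exp (-(Real.pi / t : ℝ) * ‖v‖ ^ 2)) := by
        congr with v
        rw [smul_comm, heat, ← Complex.coe_smul (E := ℂ)]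
        push_cast
        ring_nf
    _ = _ := by
        rw [integral_smul, hgauss, ← Complex.coe_smul, smul_eq_mul, ← mul_assoc,
          ← Complex.ofReal_mul, ← Real.rpow_add ht, neg_add_cancel, Real.rpow_zero]
        push_cast
        field_simp

lemma integral_exp_neg_pi_norm_sq_div {t : ℝ} (ht : 0 < t) :
    ∫ v : W, Real.exp (-(Real.pi * ‖v‖ ^ 2 / t)) = t ^ (Module.finrank ℝ W / 2 : ℝ) := by
  have h := GaussianFourier.integral_rexp_neg_mul_sq_norm (V := W) (div_pos Real.pi_pos ht)
  rw [div_div_cancel₀ Real.pi_ne_zero] at h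
  rw [← h]
  congr with v
  ring_nf

lemma integrable_heat {t : ℝ} (ht : 0 < t) : Integrable (heat t : W → ℝ) := by
  refine .const_mul (.of_integral_ne_zero ?_) _
  rw [integral_exp_neg_pi_norm_sq_div ht]
  positivity

lemma lintegral_heat_sub {t : ℝ} (ht : 0 < t) (x : W) :
    ∫⁻ v : W, ENNReal.ofReal (heat t (v - x)) = 1 := by
  rw [lintegral_sub_right_eq_self (fun v => ENNReal.ofReal (heat t v)) x,
    lintegral_ofReal_eq_of_integral_eq (.of_forall (heat_nonneg ht)) (c := 1) _ one_ne_zero,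
    ENNReal.ofReal_one]
  simp only [heat]
  rw [integral_const_mul, integral_exp_neg_pi_norm_sq_div ht, ← Real.rpow_add ht, neg_add_cancel,
    Real.rpow_zero]

lemma lconvolution_heat {s t : ℝ} (hs : 0 < s) (ht : 0 < t) (x : W) :
    ((fun v : W => ENNReal.ofReal (heat s v)) ⋆ₗ fun v => ENNReal.ofReal (heat t v)) x =
      ENNReal.ofReal (heat (s + t) x) := by
  have hst : 0 < s * t / (s + t) := by positivity
  simp only [lconvolution_def, ← ENNReal.ofReal_mul (heat_nonneg hs _), heat_mul_heat hs ht,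
    ENNReal.ofReal_mul (heat_nonneg (add_pos hs ht) _)]
  rw [lintegral_const_mul' _ _ ofReal_ne_top, lintegral_heat_sub hst, mul_one]

lemma lconvolution_riesz {α β : ℝ} (hα : 0 < α) (hβ : 0 < β) :
    (riesz α ⋆ₗ riesz β : W → ℝ≥0∞) = riesz (α + β) := by
  ext x
  have hpos : ∀ᵐ p ∂(liouville α).prod (liouville β), 0 < p.1 ∧ 0 < p.2 :=
    (Measure.quasiMeasurePreserving_fst.ae (ae_liouville_pos α)).and
      (Measure.quasiMeasurePreserving_snd.ae (ae_liouville_pos β))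
  calc (riesz α ⋆ₗ riesz β) x
      = ∫⁻ v, (∫⁻ p, ENNReal.ofReal (heat p.1 v) * ENNReal.ofReal (heat p.2 (-v + x))
          ∂(liouville α).prod (liouville β)) :=
        lintegral_congr fun v => (lintegral_prod_mul (by fun_prop) (by fun_prop)).symm
    _ = ∫⁻ p, ((fun v => ENNReal.ofReal (heat p.1 v)) ⋆ₗ
          fun v => ENNReal.ofReal (heat p.2 v)) x ∂(liouville α).prod (liouville β) :=
        lintegral_lintegral_swap (by fun_prop)
    _ = ∫⁻ p, ENNReal.ofReal (heat (p.1 + p.2) x) ∂(liouville α).prod (liouville β) :=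
        lintegral_congr_ae (hpos.mono fun p hp => lconvolution_heat hp.1 hp.2 x)
    _ = riesz (α + β) x := by
        rw [riesz, ← liouville_conv_liouville hα hβ,
          Measure.lintegral_conv_eq_lintegral_sum (by fun_prop)]

end HeatKernel

lemma two_mul_mul_le_weighted {p q : ℝ≥0∞} (hp : p ≠ 0) (hp' : p ≠ ⊤) (hq : q ≠ 0) (hq' : q ≠ ⊤)
    (x y : ℝ≥0∞) : 2 * (x * y) ≤ x ^ 2 * (q / p) + y ^ 2 * (p / q) := by
  rcases eq_or_ne x ⊤ with rfl | hx
  · simp [ENNReal.div_eq_zero_iff, hq, hp']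
  rcases eq_or_ne y ⊤ with rfl | hy
  · simp [ENNReal.div_eq_zero_iff, hp, hq']
  lift p to NNReal using hp'
  lift q to NNReal using hq'
  lift x to NNReal using hx
  lift y to NNReal using hy
  norm_cast at hp hq ⊢
  rw [← ENNReal.coe_div hp, ← ENNReal.coe_div hq]
  norm_cast
  rw [← NNReal.coe_le_coe]
  push_cast
  have : (0 : ℝ) < p := by positivity
  have : (0 : ℝ) < q := by positivity
  have hsq : (x : ℝ) ^ 2 * (q / p) + y ^ 2 * (p / q) - 2 * (x * y) =
      (x * q - y * p) ^ 2 / (p * q) := by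
    field_simp
    ring
  have : 0 ≤ ((x : ℝ) * q - y * p) ^ 2 / (p * q) := by positivity
  linarith

section Schur

variable {V W : Type*} [AddCommGroup V] [MeasurableSpace V] [MeasurableAdd₂ V]
  [MeasurableSpace W] {μ : Measure V} {ν : Measure W}

lemma lintegral_lintegral_shift_div_le [SFinite μ] [SFinite ν] {A : W → V}
    (hAm : Measurable A) {k : W → ℝ≥0∞} (hkm : Measurable k) {p c φ : V → ℝ≥0∞}
    (hpm : Measurable p) (hφ : Measurable φ) (hp : ∀ᵐ w ∂μ, p w ≠ 0 ∧ p w ≠ ⊤)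
    (hc : ∀ᵐ w ∂μ, ∫⁻ ζ, k ζ * p (w + A ζ) ∂ν ≤ c w * p w) :
    ∫⁻ ζ, k ζ * ∫⁻ w, φ w ^ 2 * (p (w + A ζ) / p w) ∂μ ∂ν ≤ ∫⁻ w, c w * φ w ^ 2 ∂μ := by
  calc ∫⁻ ζ, k ζ * ∫⁻ w, φ w ^ 2 * (p (w + A ζ) / p w) ∂μ ∂ν
      = ∫⁻ ζ, (∫⁻ w, k ζ * (φ w ^ 2 * (p (w + A ζ) / p w)) ∂μ) ∂ν :=
        lintegral_congr fun ζ => (lintegral_const_mul _ (by fun_prop)).symm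
    _ = ∫⁻ w, φ w ^ 2 / p w * ∫⁻ ζ, k ζ * p (w + A ζ) ∂ν ∂μ := by
        rw [lintegral_lintegral_swap (by fun_prop)]
        refine lintegral_congr fun w => ?_
        rw [← lintegral_const_mul _ (by fun_prop)]
        refine lintegral_congr fun ζ => ?_
        simp only [div_eq_mul_inv]
        ring
    _ ≤ ∫⁻ w, c w * φ w ^ 2 ∂μ := by
        refine lintegral_mono_ae ?_
        filter_upwards [hp, hc] with w hw hcw
        calc φ w ^ 2 / p w * ∫⁻ ζ, k ζ * p (w + A ζ) ∂ν ≤ φ w ^ 2 / p w * (c w * p w) := by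
              gcongr
          _ = c w * φ w ^ 2 := by rw [mul_left_comm, ENNReal.div_mul_cancel hw.1 hw.2]

variable [AddCommGroup W] [MeasurableNeg W] [μ.IsAddRightInvariant] [ν.IsNegInvariant]

lemma lintegral_lintegral_shift_symm {A : W → V} (hA : Function.Odd A) {k : W → ℝ≥0∞}
    (hk : Function.Even k) (Φ : V → V → ℝ≥0∞) :
    ∫⁻ ζ, k ζ * ∫⁻ w, Φ (w + A ζ) w ∂μ ∂ν = ∫⁻ ζ, k ζ * ∫⁻ w, Φ w (w + A ζ) ∂μ ∂ν := by
  rw [← lintegral_neg_eq_self]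
  refine lintegral_congr fun ζ => ?_
  rw [hk, ← lintegral_add_right_eq_self _ (A ζ)]
  simp only [hA ζ, add_neg_cancel_right]

/-- With the test function `p`, weigh `φ (w + A ζ) φ w` by `p w / p (w + A ζ)`. -/
lemma schur_test [SFinite μ] [SFinite ν] {A : W → V} (hA : Function.Odd A)
    (hAm : Measurable A) {k : W → ℝ≥0∞} (hk : Function.Even k) (hkm : Measurable k)
    {p c φ : V → ℝ≥0∞} (hpm : Measurable p) (hφ : Measurable φ) (hp : ∀ᵐ w ∂μ, p w ≠ 0 ∧ p w ≠ ⊤)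
    (hc : ∀ᵐ w ∂μ, ∫⁻ ζ, k ζ * p (w + A ζ) ∂ν ≤ c w * p w) :
    ∫⁻ ζ, k ζ * ∫⁻ w, φ (w + A ζ) * φ w ∂μ ∂ν ≤ ∫⁻ w, c w * φ w ^ 2 ∂μ := by
  have hamgm (ζ : W) : 2 * ∫⁻ w, φ (w + A ζ) * φ w ∂μ ≤
      ∫⁻ w, φ (w + A ζ) ^ 2 * (p w / p (w + A ζ)) ∂μ +
        ∫⁻ w, φ w ^ 2 * (p (w + A ζ) / p w) ∂μ := by
    rw [← lintegral_const_mul' _ _ (by finiteness), ← lintegral_add_left (by fun_prop)]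
    have hshift : ∀ᵐ w ∂μ, p (w + A ζ) ≠ 0 ∧ p (w + A ζ) ≠ ⊤ :=
      (measurePreserving_add_right μ (A ζ)).quasiMeasurePreserving.ae hp
    refine lintegral_mono_ae ?_
    filter_upwards [hp, hshift] with w hw hwζ
    exact two_mul_mul_le_weighted hwζ.1 hwζ.2 hw.1 hw.2 _ _
  have hmeas : Measurable fun ζ => k ζ * ∫⁻ w, φ (w + A ζ) ^ 2 * (p w / p (w + A ζ)) ∂μ :=
    hkm.mul (Measurable.lintegral_prod_right'
      (f := fun q : W × V => φ (q.2 + A q.1) ^ 2 * (p q.2 / p (q.2 + A q.1))) (by fun_prop))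
  refine (ENNReal.mul_le_mul_iff_right two_ne_zero ofNat_ne_top).1 ?_
  calc 2 * ∫⁻ ζ, k ζ * ∫⁻ w, φ (w + A ζ) * φ w ∂μ ∂ν
      = ∫⁻ ζ, k ζ * (2 * ∫⁻ w, φ (w + A ζ) * φ w ∂μ) ∂ν := by
        rw [← lintegral_const_mul' _ _ (by finiteness)]
        simp only [mul_left_comm]
    _ ≤ ∫⁻ ζ, k ζ * (∫⁻ w, φ (w + A ζ) ^ 2 * (p w / p (w + A ζ)) ∂μ +
          ∫⁻ w, φ w ^ 2 * (p (w + A ζ) / p w) ∂μ) ∂ν :=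
        lintegral_mono fun ζ => mul_le_mul_right (hamgm ζ) _
    _ = 2 * ∫⁻ ζ, k ζ * ∫⁻ w, φ w ^ 2 * (p (w + A ζ) / p w) ∂μ ∂ν := by
        simp only [mul_add]
        rw [lintegral_add_left hmeas,
          lintegral_lintegral_shift_symm hA hk (fun v w => φ v ^ 2 * (p w / p v)), two_mul]
    _ ≤ 2 * ∫⁻ w, c w * φ w ^ 2 ∂μ := by
        gcongr
        exact lintegral_lintegral_shift_div_le hAm hkm hpm hφ hp hc

end Schur

lemma enorm_sq_eq_ofReal {H : Type*} [NormedAddCommGroup H] (v : H) :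
    ‖v‖ₑ ^ 2 = ENNReal.ofReal (‖v‖ ^ 2) := by
  rw [ENNReal.ofReal_pow (norm_nonneg v), ofReal_norm]

lemma enorm_complex_ofReal (r : ℝ) : ‖(r : ℂ)‖ₑ = ‖r‖ₑ := by
  rw [← ofReal_norm, Complex.norm_real, ofReal_norm]

section FourierTranslation

variable {V H : Type*} [NormedAddCommGroup V] [InnerProductSpace ℝ V] [FiniteDimensional ℝ V]
  [MeasurableSpace V] [BorelSpace V] [NormedAddCommGroup H] [InnerProductSpace ℂ H]

lemma fourier_compSubConstCLM (f : 𝓢(V, H)) (h w : V) :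
    𝓕 (f.compSubConstCLM ℂ h) w = Real.fourierChar (-⟪h, w⟫_ℝ) • 𝓕 f w := by
  have := congrFun (VectorFourier.fourierIntegral_comp_add_right Real.fourierChar volume
    (innerₗ V) f (-h)) w
  simpa [← sub_eq_add_neg] using! this

lemma fourierInv_compSubConstCLM (f : 𝓢(V, H)) (h x : V) :
    𝓕⁻ (f.compSubConstCLM ℂ h) x = Real.fourierChar ⟪h, x⟫_ℝ • 𝓕⁻ f x := by
  have := fourier_compSubConstCLM f h (-x)
  rwa [inner_neg_right, neg_neg] at this

lemma integrable_norm_sq (f : 𝓢(V, H)) : Integrable fun x => ‖f x‖ ^ 2 :=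
  (f.memLp 2).integrable_norm_pow two_ne_zero

variable [CompleteSpace H]

lemma lintegral_enorm_sq_fourier (f : 𝓢(V, H)) :
    ∫⁻ w, ‖𝓕 f w‖ₑ ^ 2 = ∫⁻ x, ‖f x‖ₑ ^ 2 := by
  simp only [enorm_sq_eq_ofReal]
  rw [← ofReal_integral_eq_lintegral_ofReal (integrable_norm_sq _)
      (.of_forall fun _ => by positivity),
    ← ofReal_integral_eq_lintegral_ofReal (integrable_norm_sq _)
      (.of_forall fun _ => by positivity),
    SchwartzMap.integral_norm_sq_fourier]

lemma norm_fourierChar_sub_one_sq (θ : ℝ) :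
    ‖(Real.fourierChar θ : ℂ) - 1‖ ^ 2 = 2 * (1 - Real.cos (2 * Real.pi * θ)) := by
  rw [Real.fourierChar_apply, ← Complex.normSq_eq_norm_sq, Complex.normSq_apply]
  simp only [Complex.sub_re, Complex.sub_im, Complex.exp_ofReal_mul_I_re,
    Complex.exp_ofReal_mul_I_im, Complex.one_re, Complex.one_im]
  linear_combination Real.sin_sq_add_cos_sq (2 * Real.pi * θ)

lemma lintegral_enorm_sub_translate_sq (f : 𝓢(V, H)) (h : V) :
    ∫⁻ x, ‖f x - f (x + h)‖ₑ ^ 2 =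
      ∫⁻ w, ENNReal.ofReal (2 * (1 - Real.cos (2 * Real.pi * ⟪h, w⟫_ℝ))) * ‖𝓕 f w‖ₑ ^ 2 := by
  have hplancherel := lintegral_enorm_sq_fourier (f.compSubConstCLM ℂ (-h) - f)
  have hfourier (w : V) : 𝓕 (f.compSubConstCLM ℂ (-h) - f) w =
      ((Real.fourierChar ⟪h, w⟫_ℝ : ℂ) - 1) • 𝓕 f w := by
    rw [← FourierTransform.fourierₗ_apply (R := ℂ), map_sub, FourierTransform.fourierₗ_apply,
      FourierTransform.fourierₗ_apply, sub_apply, fourier_compSubConstCLM, inner_neg_left, neg_neg,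
      Circle.smul_def, sub_smul, one_smul]
  simp only [hfourier, enorm_smul, mul_pow, enorm_sq_eq_ofReal (_ - 1 : ℂ),
    norm_fourierChar_sub_one_sq] at hplancherel
  rw [hplancherel]
  simp only [sub_apply, SchwartzMap.compSubConstCLM_apply, sub_neg_eq_add, enorm_sub_rev]

lemma integral_fourierChar_smul_norm_sq (f : 𝓢(V, H)) (h : V) :
    ∫ x, Real.fourierChar ⟪h, x⟫_ℝ • (‖f x‖ ^ 2 : ℂ) = ∫ w, ⟪𝓕 f w, 𝓕 f (w - h)⟫_ℂ := by
  have hplancherel := SchwartzMap.integral_inner_fourier_fourier f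
    (𝓕⁻ ((𝓕 f).compSubConstCLM ℂ h))
  simp only [FourierTransform.fourier_fourierInv_eq, SchwartzMap.compSubConstCLM_apply,
    fourierInv_compSubConstCLM, FourierTransform.fourierInv_fourier_eq] at hplancherel
  rw [hplancherel]
  congr with x
  simp only [Circle.smul_def, inner_smul_right, inner_self_eq_norm_sq_to_K, smul_eq_mul]
  rfl

variable {W : Type*} [NormedAddCommGroup W] [InnerProductSpace ℝ W] [FiniteDimensional ℝ W]
  [MeasurableSpace W] [BorelSpace W]

lemma integral_gaussian_mul_norm_sq (T : V →L[ℝ] W) (f : 𝓢(V, H)) {t : ℝ} (ht : 0 < t) :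
    ∫ x, (Real.exp (-(Real.pi * ‖T x‖ ^ 2 * t)) * ‖f x‖ ^ 2 : ℂ) =
      ∫ ζ : W, heat t ζ * ∫ w, ⟪𝓕 f w, 𝓕 f (w + T.adjoint ζ)⟫_ℂ := by
  have hswap := VectorFourier.integral_bilin_fourierIntegral_eq_flip (μ := volume) (ν := volume)
    (f := fun ζ => (heat t ζ : ℂ)) (g := fun x => (‖f x‖ ^ 2 : ℂ))
    (ContinuousLinearMap.mul ℂ ℂ) (L := (innerₗ W).compl₂ T.toLinearMap)
    Real.continuous_fourierChar (by
      simp only [LinearMap.compl₂_apply, ContinuousLinearMap.coe_coe, innerₗ_apply_apply]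
      fun_prop)
    (integrable_heat (W := W) ht).ofReal (mod_cast (integrable_norm_sq f).ofReal (𝕜 := ℂ))
  have hheat (x : V) : VectorFourier.fourierIntegral Real.fourierChar volume
      ((innerₗ W).compl₂ T.toLinearMap) (fun ζ => (heat t ζ : ℂ)) x =
        Real.exp (-(Real.pi * ‖T x‖ ^ 2 * t)) := by
    rw [mul_right_comm, ← fourier_heat ht]
    rfl
  have hcorr (ζ : W) : VectorFourier.fourierIntegral Real.fourierChar volume
      ((innerₗ W).compl₂ T.toLinearMap).flip (fun x => (‖f x‖ ^ 2 : ℂ)) ζ =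
        ∫ w, ⟪𝓕 f w, 𝓕 f (w + T.adjoint ζ)⟫_ℂ := by
    simp only [← sub_neg_eq_add _ (T.adjoint ζ), ← integral_fourierChar_smul_norm_sq,
      inner_neg_left, ContinuousLinearMap.adjoint_inner_left]
    simp only [VectorFourier.fourierIntegral, LinearMap.flip_apply, LinearMap.compl₂_apply,
      ContinuousLinearMap.coe_coe, innerₗ_apply_apply]
  simpa only [ContinuousLinearMap.mul_apply', hheat, hcorr] using hswap

lemma lintegral_gaussian_mul_enorm_sq_le (T : V →L[ℝ] W) (f : 𝓢(V, H)) {t : ℝ} (ht : 0 < t) :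
    ∫⁻ x, ENNReal.ofReal (Real.exp (-(Real.pi * ‖T x‖ ^ 2 * t))) * ‖f x‖ₑ ^ 2 ≤
      ∫⁻ ζ, ENNReal.ofReal (heat t ζ) * ∫⁻ w, ‖𝓕 f (w + T.adjoint ζ)‖ₑ * ‖𝓕 f w‖ₑ := by
  have hexp (x : V) : ‖Real.exp (-(Real.pi * ‖T x‖ ^ 2 * t))‖ ≤ 1 := by
    rw [Real.norm_of_nonneg (Real.exp_pos _).le, Real.exp_le_one_iff, neg_nonpos]
    positivity
  have hint : Integrable fun x => Real.exp (-(Real.pi * ‖T x‖ ^ 2 * t)) * ‖f x‖ ^ 2 :=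
    (integrable_norm_sq f).bdd_mul (by fun_prop) (.of_forall hexp)
  simp only [enorm_sq_eq_ofReal, ← ENNReal.ofReal_mul (Real.exp_pos _).le]
  calc ∫⁻ x, ENNReal.ofReal (Real.exp (-(Real.pi * ‖T x‖ ^ 2 * t)) * ‖f x‖ ^ 2)
      = ‖∫ x, (Real.exp (-(Real.pi * ‖T x‖ ^ 2 * t)) * ‖f x‖ ^ 2 : ℂ)‖ₑ := by
        rw [← ofReal_integral_eq_lintegral_ofReal hint (.of_forall fun _ => by positivity),
          ← Real.enorm_of_nonneg (integral_nonneg fun _ => by positivity),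
          ← enorm_complex_ofReal, ← integral_complex_ofReal]
        push_cast
        rfl
    _ ≤ ∫⁻ ζ : W, ‖heat t ζ * ∫ w, ⟪𝓕 f w, 𝓕 f (w + T.adjoint ζ)⟫_ℂ‖ₑ := by
        rw [integral_gaussian_mul_norm_sq T f ht]
        exact enorm_integral_le_lintegral_enorm _
    _ ≤ ∫⁻ ζ, ENNReal.ofReal (heat t ζ) * ∫⁻ w, ‖𝓕 f (w + T.adjoint ζ)‖ₑ * ‖𝓕 f w‖ₑ := by
        refine lintegral_mono fun ζ => ?_
        rw [enorm_mul, enorm_complex_ofReal, Real.enorm_of_nonneg (heat_nonneg ht ζ)]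
        gcongr
        refine (enorm_integral_le_lintegral_enorm _).trans (lintegral_mono fun w => ?_)
        rw [mul_comm]
        simp only [← ofReal_norm, ← ENNReal.ofReal_mul (norm_nonneg _)]
        exact ofReal_le_ofReal (norm_inner_le_norm _ _)

end FourierTranslation

/-- The constant of Pitt's inequality for a linear map `T` onto an `m`-dimensional space with
`T T† = κ`; `constF n` is the case `m = n`, `κ = 2`. -/
def pittConst (m κ lam : ℝ) : ℝ :=
  (Real.pi / κ) ^ lam * (Real.Gamma ((m - lam) / 4) / Real.Gamma ((m + lam) / 4)) ^ 2

lemma ae_apply_ne_zero {V W : Type*} [NormedAddCommGroup V] [NormedSpace ℝ V]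
    [FiniteDimensional ℝ V] [MeasurableSpace V] [BorelSpace V] [NormedAddCommGroup W]
    [NormedSpace ℝ W] {T : V →L[ℝ] W} (hT : T ≠ 0) {μ : Measure V} [μ.IsAddHaarMeasure] :
    ∀ᵐ x ∂μ, T x ≠ 0 := by
  have := Measure.addHaar_submodule μ T.ker (by
    rwa [Ne, LinearMap.ker_eq_top, ← ContinuousLinearMap.toLinearMap_zero,
      ContinuousLinearMap.coe_inj])
  rw [ae_iff]
  simpa using! this

lemma ne_zero_of_apply_adjoint {V W : Type*} [NormedAddCommGroup V] [InnerProductSpace ℝ V]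
    [CompleteSpace V] [NormedAddCommGroup W] [InnerProductSpace ℝ W] [CompleteSpace W]
    {T : V →L[ℝ] W} {κ : ℝ} (hκ : κ ≠ 0) (hT : ∀ ζ, T (T.adjoint ζ) = κ • ζ)
    (hW : 0 < Module.finrank ℝ W) : T ≠ 0 := by
  have := Module.nontrivial_of_finrank_pos hW
  obtain ⟨ζ, hζ⟩ := exists_ne (0 : W)
  rintro rfl
  exact smul_ne_zero hκ hζ (hT ζ).symm

section Pitt

variable {V W H : Type*} [NormedAddCommGroup V] [InnerProductSpace ℝ V] [FiniteDimensional ℝ V]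
  [NormedAddCommGroup W] {κ lam : ℝ}

lemma ofReal_norm_rpow_neg (hlam : 0 < lam) {v : W} (hv : v ≠ 0) :
    ENNReal.ofReal (‖v‖ ^ (-lam)) = ENNReal.ofReal (Real.pi ^ (lam / 2)) *
      ∫⁻ t, ENNReal.ofReal (Real.exp (-(Real.pi * ‖v‖ ^ 2 * t))) ∂liouville (lam / 2) := by
  rw [lintegral_exp_neg_mul_liouville (half_pos hlam) (by positivity),
    ← ENNReal.ofReal_mul (by positivity), Real.mul_rpow Real.pi_pos.le (by positivity),
    ← mul_assoc, ← Real.rpow_add Real.pi_pos, add_neg_cancel, Real.rpow_zero, one_mul,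
    ← Real.rpow_natCast, ← Real.rpow_mul (norm_nonneg v)]
  congr 2
  push_cast
  ring

lemma pi_rpow_mul_norm_inv_smul_rpow [NormedSpace ℝ W] (hκ : 0 < κ) (v : W) :
    Real.pi ^ (lam / 2) * (Real.pi * ‖κ⁻¹ • v‖ ^ 2) ^ (lam / 2) =
      (Real.pi / κ) ^ lam * ‖v‖ ^ lam := by
  rw [← Real.mul_rpow Real.pi_pos.le (by positivity), ← Real.mul_rpow (by positivity)
    (norm_nonneg v), norm_smul, Real.norm_of_nonneg (inv_nonneg.2 hκ.le),
    show Real.pi * (Real.pi * (κ⁻¹ * ‖v‖) ^ 2) = (Real.pi / κ * ‖v‖) ^ 2 by ring,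
    ← Real.rpow_natCast, ← Real.rpow_mul (by positivity)]
  congr 1
  push_cast
  ring

variable [InnerProductSpace ℝ W] {T : V →L[ℝ] W}

lemma rpow_mul_riesz_add_div_four (hκ : 0 < κ) (hlam : 0 < lam) (hlamW : lam < Module.finrank ℝ W)
    {v : W} (hv : v ≠ 0) :
    ENNReal.ofReal (Real.pi ^ (lam / 2)) *
        riesz ((Module.finrank ℝ W + lam) / 4) (κ⁻¹ • v) =
      ENNReal.ofReal (pittConst (Module.finrank ℝ W) κ lam * ‖v‖ ^ lam) *
        riesz ((Module.finrank ℝ W - lam) / 4) (κ⁻¹ • v) := by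
  have hv' : κ⁻¹ • v ≠ 0 := smul_ne_zero (inv_ne_zero hκ.ne') hv
  rw [riesz_eq (by linarith) (by linarith) hv', riesz_eq (by linarith) (by linarith) hv',
    ← ENNReal.ofReal_mul (by positivity), ← ENNReal.ofReal_mul (by unfold pittConst; positivity)]
  set m : ℝ := (Module.finrank ℝ W : ℝ)
  have hadd := Real.Gamma_pos_of_pos (show 0 < (m + lam) / 4 by linarith)
  have hsub := Real.Gamma_pos_of_pos (show 0 < (m - lam) / 4 by linarith)
  rw [show m / 2 - (m + lam) / 4 = (m - lam) / 4 by ring,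
    show m / 2 - (m - lam) / 4 = (m + lam) / 4 by ring,
    show (m + lam) / 4 - m / 2 = lam / 2 + ((m - lam) / 4 - m / 2) by ring,
    Real.rpow_add (by positivity), pittConst, mul_right_comm (_ ^ lam),
    ← pi_rpow_mul_norm_inv_smul_rpow hκ]
  generalize (Real.pi * ‖κ⁻¹ • v‖ ^ 2) ^ ((m - lam) / 4 - m / 2) = a
  generalize (Real.pi * ‖κ⁻¹ • v‖ ^ 2) ^ (lam / 2) = b
  congr 1
  field_simp

variable [FiniteDimensional ℝ W] [MeasurableSpace W] [BorelSpace W]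

lemma lintegral_riesz_mul_riesz (hκ : 0 < κ)
    (hT : ∀ ζ, T (T.adjoint ζ) = κ • ζ) (hlam : 0 < lam) (hlamW : lam < Module.finrank ℝ W)
    {w : V} (hw : T w ≠ 0) :
    ∫⁻ ζ, ENNReal.ofReal (Real.pi ^ (lam / 2)) * riesz (lam / 2) ζ *
        riesz ((Module.finrank ℝ W - lam) / 4) (κ⁻¹ • T (w + T.adjoint ζ)) =
      ENNReal.ofReal (pittConst (Module.finrank ℝ W) κ lam * ‖T w‖ ^ lam) *
        riesz ((Module.finrank ℝ W - lam) / 4) (κ⁻¹ • T w) := by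
  simp only [mul_assoc]
  rw [← rpow_mul_riesz_add_div_four hκ hlam hlamW hw, lintegral_const_mul' _ _ ofReal_ne_top,
    show (Module.finrank ℝ W + lam) / 4 = lam / 2 + (Module.finrank ℝ W - lam) / 4 by ring,
    ← lconvolution_riesz (by linarith) (by linarith), lconvolution_def,
    ← lintegral_neg_eq_self]
  congr with ζ
  rw [map_neg, map_add, map_neg, hT, smul_add, smul_neg, inv_smul_smul₀ hκ.ne', riesz_neg,
    add_comm]

variable [MeasurableSpace V] [BorelSpace V]
  [NormedAddCommGroup H] [InnerProductSpace ℂ H] [CompleteSpace H]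

lemma lintegral_rpow_neg_mul_enorm_sq_le_riesz (hT : T ≠ 0) (hlam : 0 < lam) (f : 𝓢(V, H)) :
    ∫⁻ x, ENNReal.ofReal (‖T x‖ ^ (-lam)) * ‖f x‖ₑ ^ 2 ≤
      ∫⁻ ζ, ENNReal.ofReal (Real.pi ^ (lam / 2)) * riesz (lam / 2) ζ *
        ∫⁻ w, ‖𝓕 f (w + T.adjoint ζ)‖ₑ * ‖𝓕 f w‖ₑ := by
  calc ∫⁻ x, ENNReal.ofReal (‖T x‖ ^ (-lam)) * ‖f x‖ₑ ^ 2
      = ∫⁻ x, ENNReal.ofReal (Real.pi ^ (lam / 2)) *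
          ∫⁻ t, ENNReal.ofReal (Real.exp (-(Real.pi * ‖T x‖ ^ 2 * t))) * ‖f x‖ₑ ^ 2
            ∂liouville (lam / 2) := by
        refine lintegral_congr_ae ((ae_apply_ne_zero hT).mono fun x hx => ?_)
        simp only [ofReal_norm_rpow_neg hlam hx, mul_assoc]
        rw [lintegral_mul_const _ (by fun_prop)]
    _ = ENNReal.ofReal (Real.pi ^ (lam / 2)) *
          ∫⁻ t, (∫⁻ x, ENNReal.ofReal (Real.exp (-(Real.pi * ‖T x‖ ^ 2 * t))) * ‖f x‖ₑ ^ 2)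
            ∂liouville (lam / 2) := by
        rw [lintegral_const_mul' _ _ ofReal_ne_top, lintegral_lintegral_swap (by fun_prop)]
    _ ≤ ENNReal.ofReal (Real.pi ^ (lam / 2)) *
          ∫⁻ t, (∫⁻ ζ, ENNReal.ofReal (heat t ζ) *
            ∫⁻ w, ‖𝓕 f (w + T.adjoint ζ)‖ₑ * ‖𝓕 f w‖ₑ) ∂liouville (lam / 2) := by
        gcongr 1
        exact lintegral_mono_ae ((ae_liouville_pos _).mono fun t ht =>
          lintegral_gaussian_mul_enorm_sq_le T f ht)
    _ = _ := by
        rw [lintegral_lintegral_swap (by fun_prop), ← lintegral_const_mul' _ _ ofReal_ne_top]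
        refine lintegral_congr fun ζ => ?_
        rw [lintegral_mul_const _ (by fun_prop), ← riesz, mul_assoc]

/-- Schur's test on the frequency side, with a power of `‖T w‖` as test function. -/
theorem lintegral_pitt (hκ : 0 < κ) (hT : ∀ ζ, T (T.adjoint ζ) = κ • ζ) (hlam : 0 < lam)
    (hlamW : lam < Module.finrank ℝ W) (f : 𝓢(V, H)) :
    ∫⁻ x, ENNReal.ofReal (‖T x‖ ^ (-lam)) * ‖f x‖ₑ ^ 2 ≤
      ENNReal.ofReal (pittConst (Module.finrank ℝ W) κ lam) *
        ∫⁻ w, ENNReal.ofReal (‖T w‖ ^ lam) * ‖𝓕 f w‖ₑ ^ 2 := by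
  have hT0 := ne_zero_of_apply_adjoint hκ.ne' hT (mod_cast hlam.trans hlamW)
  calc ∫⁻ x, ENNReal.ofReal (‖T x‖ ^ (-lam)) * ‖f x‖ₑ ^ 2
      ≤ ∫⁻ ζ, ENNReal.ofReal (Real.pi ^ (lam / 2)) * riesz (lam / 2) ζ *
          ∫⁻ w, ‖𝓕 f (w + T.adjoint ζ)‖ₑ * ‖𝓕 f w‖ₑ :=
        lintegral_rpow_neg_mul_enorm_sq_le_riesz hT0 hlam f
    _ ≤ ∫⁻ w, ENNReal.ofReal (pittConst (Module.finrank ℝ W) κ lam * ‖T w‖ ^ lam) *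
          ‖𝓕 f w‖ₑ ^ 2 := by
        refine schur_test (p := fun w => riesz ((Module.finrank ℝ W - lam) / 4) (κ⁻¹ • T w))
          (map_neg T.adjoint) (by fun_prop) (fun ζ => by rw [riesz_neg]) (by fun_prop)
          (by fun_prop) (𝓕 f).continuous.enorm.measurable ?_ ?_
        · filter_upwards [ae_apply_ne_zero hT0] with w hw
          have hw' : κ⁻¹ • T w ≠ 0 := smul_ne_zero (inv_ne_zero hκ.ne') hw
          rw [riesz_eq (by linarith) (by linarith) hw']
          have := Real.Gamma_pos_of_pos
            (show 0 < Module.finrank ℝ W / 2 - (Module.finrank ℝ W - lam) / 4 by linarith)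
          have := Real.Gamma_pos_of_pos
            (show 0 < (Module.finrank ℝ W - lam) / 4 by linarith)
          exact ⟨(ofReal_pos.2 (by positivity)).ne', ofReal_ne_top⟩
        · filter_upwards [ae_apply_ne_zero hT0] with w hw
          exact (lintegral_riesz_mul_riesz hκ hT hlam hlamW hw).le
    _ = _ := by
        rw [← lintegral_const_mul' _ _ ofReal_ne_top]
        refine lintegral_congr fun w => ?_
        rw [ENNReal.ofReal_mul (by unfold pittConst; positivity), mul_assoc]

end Pitt

lemma pittConst_pos {m κ lam : ℝ} (hκ : 0 < κ) (hlam : -m < lam) (hlamm : lam < m) :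
    0 < pittConst m κ lam := by
  have := Real.Gamma_pos_of_pos (show 0 < (m - lam) / 4 by linarith)
  have := Real.Gamma_pos_of_pos (show 0 < (m + lam) / 4 by linarith)
  unfold pittConst
  positivity

section NormRpow

variable {V W H : Type*} [NormedAddCommGroup V] [InnerProductSpace ℝ V] [FiniteDimensional ℝ V]
  [MeasurableSpace V] [BorelSpace V] [NormedAddCommGroup W] [InnerProductSpace ℝ W]
  [NormedAddCommGroup H] {T : V →L[ℝ] W} {κ lam : ℝ}

lemma lintegral_norm_rpow_mul_enorm_sq (T : V →L[ℝ] W) (s : ℝ) (g : V → H) :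
    ∫⁻ x, ENNReal.ofReal (‖T x‖ ^ s) * ‖g x‖ₑ ^ 2 =
      ∫⁻ x, ENNReal.ofReal (‖T x‖ ^ s * ‖g x‖ ^ 2) := by
  refine lintegral_congr fun x => ?_
  rw [ENNReal.ofReal_mul (by positivity), enorm_sq_eq_ofReal]

lemma integrable_norm_rpow_mul_norm_sq_of_nonneg [NormedSpace ℝ H] (T : V →L[ℝ] W) {s : ℝ}
    (hs : 0 ≤ s) (f : 𝓢(V, H)) : Integrable fun x => ‖T x‖ ^ s * ‖f x‖ ^ 2 := by
  obtain ⟨C, -, hC⟩ := f.decay 0 0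
  simp only [pow_zero, one_mul, norm_iteratedFDeriv_zero] at hC
  have hbound : Integrable fun x => (‖f x‖ + ‖T‖ ^ ⌈s⌉₊ * (‖x‖ ^ ⌈s⌉₊ * ‖f x‖)) * C :=
    (f.integrable.norm.add ((f.integrable_pow_mul volume ⌈s⌉₊).const_mul _)).mul_const C
  have hpow (x : V) : ‖T x‖ ^ s ≤ 1 + (‖T‖ * ‖x‖) ^ ⌈s⌉₊ := by
    rcases le_total ‖T x‖ 1 with hx | hx
    · exact (Real.rpow_le_one (norm_nonneg _) hx hs).trans (le_add_of_nonneg_right (by positivity))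
    · calc ‖T x‖ ^ s ≤ ‖T x‖ ^ (⌈s⌉₊ : ℝ) :=
            Real.rpow_le_rpow_of_exponent_le hx (Nat.le_ceil s)
        _ = ‖T x‖ ^ ⌈s⌉₊ := Real.rpow_natCast _ _
        _ ≤ (‖T‖ * ‖x‖) ^ ⌈s⌉₊ := by gcongr; exact T.le_opNorm x
        _ ≤ 1 + (‖T‖ * ‖x‖) ^ ⌈s⌉₊ := le_add_of_nonneg_left zero_le_one
  refine hbound.mono' (by have := f.continuous.norm.measurable; fun_prop) (.of_forall fun x => ?_)
  calc ‖‖T x‖ ^ s * ‖f x‖ ^ 2‖ = ‖T x‖ ^ s * (‖f x‖ * ‖f x‖) := by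
        rw [Real.norm_of_nonneg (by positivity), sq]
    _ ≤ (1 + (‖T‖ * ‖x‖) ^ ⌈s⌉₊) * (‖f x‖ * C) := by gcongr; exacts [hpow x, hC x]
    _ = _ := by ring

variable [FiniteDimensional ℝ W] [MeasurableSpace W] [BorelSpace W] [InnerProductSpace ℂ H]
  [CompleteSpace H]

lemma integrable_norm_rpow_mul_norm_sq (hκ : 0 < κ) (hT : ∀ ζ, T (T.adjoint ζ) = κ • ζ) {s : ℝ}
    (hs : -(Module.finrank ℝ W : ℝ) < s) (f : 𝓢(V, H)) :
    Integrable fun x => ‖T x‖ ^ s * ‖f x‖ ^ 2 := by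
  rcases le_or_gt 0 s with hs0 | hs0
  · exact integrable_norm_rpow_mul_norm_sq_of_nonneg T hs0 f
  have hpitt := lintegral_pitt hκ hT (neg_pos.2 hs0) (by linarith) f
  rw [neg_neg, lintegral_norm_rpow_mul_enorm_sq, lintegral_norm_rpow_mul_enorm_sq] at hpitt
  have hfreq := integrable_norm_rpow_mul_norm_sq_of_nonneg T (neg_pos.2 hs0).le (𝓕 f)
  have := f.continuous.norm.measurable
  refine (lintegral_ofReal_ne_top_iff_integrable (by fun_prop) (.of_forall fun _ => by
    positivity)).1 (ne_top_of_le_ne_top (mul_ne_top ofReal_ne_top ?_) hpitt)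
  exact hfreq.lintegral_lt_top.ne

theorem integral_pitt (hκ : 0 < κ) (hT : ∀ ζ, T (T.adjoint ζ) = κ • ζ) (hlam : 0 < lam)
    (hlamW : lam < Module.finrank ℝ W) (f : 𝓢(V, H)) :
    ∫ x, ‖T x‖ ^ (-lam) * ‖f x‖ ^ 2 ≤
      pittConst (Module.finrank ℝ W) κ lam * ∫ w, ‖T w‖ ^ lam * ‖𝓕 f w‖ ^ 2 := by
  have hC := (pittConst_pos hκ (by linarith) hlamW).le
  have hpitt := lintegral_pitt hκ hT hlam hlamW f
  rw [lintegral_norm_rpow_mul_enorm_sq, lintegral_norm_rpow_mul_enorm_sq,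
    ← ofReal_integral_eq_lintegral_ofReal (integrable_norm_rpow_mul_norm_sq hκ hT (by linarith) f)
      (.of_forall fun _ => by positivity),
    ← ofReal_integral_eq_lintegral_ofReal
      (integrable_norm_rpow_mul_norm_sq_of_nonneg T hlam.le (𝓕 f))
      (.of_forall fun _ => by positivity), ← ENNReal.ofReal_mul hC] at hpitt
  exact (ofReal_le_ofReal_iff (by positivity)).1 hpitt

end NormRpow

section LogMoment

variable {α : Type*} [MeasurableSpace α] {μ : Measure α} {r : α → ℝ}

lemma exp_mul_log_ae_eq_rpow (hr : ∀ᵐ x ∂μ, 0 < r x) (s : ℝ) :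
    (fun x => Real.exp (s * Real.log (r x))) =ᵐ[μ] fun x => r x ^ s := by
  filter_upwards [hr] with x hx
  rw [Real.rpow_def_of_pos hx, mul_comm]

lemma zero_mem_interior_integrableExpSet_log (hr : ∀ᵐ x ∂μ, 0 < r x)
    (hint : ∀ᶠ s : ℝ in 𝓝 0, Integrable (fun x => r x ^ s) μ) :
    0 ∈ interior (ProbabilityTheory.integrableExpSet (fun x => Real.log (r x)) μ) :=
  mem_interior_iff_mem_nhds.2 <| hint.mono fun s hs => hs.congr (exp_mul_log_ae_eq_rpow hr s).symm

lemma hasDerivAt_integral_rpow_zero (hr : ∀ᵐ x ∂μ, 0 < r x)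
    (hint : ∀ᶠ s : ℝ in 𝓝 0, Integrable (fun x => r x ^ s) μ) :
    HasDerivAt (fun s : ℝ => ∫ x, r x ^ s ∂μ) (∫ x, Real.log (r x) ∂μ) 0 := by
  have hmgf := ProbabilityTheory.hasDerivAt_mgf (zero_mem_interior_integrableExpSet_log hr hint)
  simp only [zero_mul, Real.exp_zero, mul_one] at hmgf
  exact hmgf.congr_of_eventuallyEq
    (.of_forall fun s => (integral_congr_ae (exp_mul_log_ae_eq_rpow hr s)).symm)

end LogMoment

lemma hasDerivAt_pittConst {m κ : ℝ} (hm : 0 < m) (hκ : 0 < κ) :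
    HasDerivAt (pittConst m κ) (Real.log (Real.pi / κ) - psi (m / 4)) 0 := by
  have hΓ := Real.Gamma_pos_of_pos (show 0 < m / 4 by linarith)
  have hd : HasDerivAt Real.Gamma (deriv Real.Gamma (m / 4)) (m / 4) :=
    (Real.differentiableAt_Gamma fun k => by
      have : (0 : ℝ) ≤ k := k.cast_nonneg
      linarith).hasDerivAt
  have hpsi : psi (m / 4) = deriv Real.Gamma (m / 4) / Real.Gamma (m / 4) :=
    (hd.log hΓ.ne').deriv
  have hsub : HasDerivAt (fun s : ℝ => Real.Gamma ((m - s) / 4))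
      (deriv Real.Gamma (m / 4) * (-1 / 4)) 0 :=
    HasDerivAt.comp 0 (h₂ := Real.Gamma) (by simpa using hd)
      (((hasDerivAt_id (0 : ℝ)).const_sub m).div_const 4)
  have hadd : HasDerivAt (fun s : ℝ => Real.Gamma ((m + s) / 4))
      (deriv Real.Gamma (m / 4) * (1 / 4)) 0 :=
    HasDerivAt.comp 0 (h₂ := Real.Gamma) (by simpa using hd)
      (((hasDerivAt_id (0 : ℝ)).const_add m).div_const 4)
  have hratio := (hsub.div hadd (by simpa using hΓ.ne')).pow 2
  have hprod := ((hasDerivAt_id (0 : ℝ)).const_rpow (show 0 < Real.pi / κ by positivity)).mul hratio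
  refine (hprod.congr_deriv ?_).congr_of_eventuallyEq (.of_forall fun s => rfl)
  rw [hpsi]
  simp only [mul_one, id_eq, Real.rpow_zero, Pi.pow_apply, Pi.div_apply, sub_zero, add_zero,
    Nat.cast_ofNat, Nat.add_one_sub_one, pow_one, one_div, one_mul]
  field_simp
  ring

lemma pittConst_zero {m κ : ℝ} (hm : 0 < m) : pittConst m κ 0 = 1 := by
  have hΓ := Real.Gamma_pos_of_pos (show 0 < m / 4 by linarith)
  simp [pittConst, div_self hΓ.ne']

lemma nonneg_of_hasDerivAt_zero {φ : ℝ → ℝ} {d : ℝ} (hd : HasDerivAt φ d 0) (h0 : φ 0 = 0)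
    (hφ : ∀ᶠ s in 𝓝[>] 0, 0 ≤ φ s) : 0 ≤ d := by
  refine ge_of_tendsto hd.tendsto_slope_zero_right ?_
  filter_upwards [hφ, self_mem_nhdsWithin] with s hs hs0
  have hs0 : (0 : ℝ) < s := hs0
  simp only [zero_add, h0, sub_zero, smul_eq_mul]
  positivity

section LogUncertainty

variable {V W H : Type*} [NormedAddCommGroup V] [InnerProductSpace ℝ V] [FiniteDimensional ℝ V]
  [MeasurableSpace V] [BorelSpace V] [NormedAddCommGroup W] [InnerProductSpace ℝ W]
  [FiniteDimensional ℝ W] [NormedAddCommGroup H] {T : V →L[ℝ] W} {κ : ℝ}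

lemma integrable_withDensity_enorm_sq_iff [NormedSpace ℝ H] (f : 𝓢(V, H)) {g : V → ℝ} :
    Integrable g (volume.withDensity fun x => ‖f x‖ₑ ^ 2) ↔
      Integrable fun x => g x * ‖f x‖ ^ 2 := by
  have := f.continuous.enorm.measurable
  rw [integrable_withDensity_iff (by fun_prop) (.of_forall fun x => by simp)]
  simp

lemma integral_withDensity_enorm_sq [NormedSpace ℝ H] (f : 𝓢(V, H)) (g : V → ℝ) :
    ∫ x, g x ∂(volume.withDensity fun x => ‖f x‖ₑ ^ 2) = ∫ x, g x * ‖f x‖ ^ 2 := by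
  have := f.continuous.enorm.measurable
  rw [integral_withDensity_eq_integral_toReal_smul (by fun_prop) (.of_forall fun x => by simp)]
  simp [mul_comm]

lemma ae_norm_apply_pos_withDensity (hκ : κ ≠ 0) (hT : ∀ ζ, T (T.adjoint ζ) = κ • ζ)
    (hW : 0 < Module.finrank ℝ W) (f : V → H) :
    ∀ᵐ x ∂(volume.withDensity fun x => ‖f x‖ₑ ^ 2), 0 < ‖T x‖ :=
  withDensity_absolutelyContinuous _ _ <|
    (ae_apply_ne_zero (ne_zero_of_apply_adjoint hκ hT hW)).mono fun _ => norm_pos_iff.2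

variable [MeasurableSpace W] [BorelSpace W] [InnerProductSpace ℂ H] [CompleteSpace H]

lemma eventually_integrable_norm_rpow_withDensity (hκ : 0 < κ)
    (hT : ∀ ζ, T (T.adjoint ζ) = κ • ζ) (hW : 0 < Module.finrank ℝ W) (f : 𝓢(V, H)) :
    ∀ᶠ s : ℝ in 𝓝 0, Integrable (fun x => ‖T x‖ ^ s) (volume.withDensity fun x => ‖f x‖ₑ ^ 2) := by
  filter_upwards [lt_mem_nhds (show -(Module.finrank ℝ W : ℝ) < 0 by simpa using hW)] with s hs
  exact (integrable_withDensity_enorm_sq_iff f).2 (integrable_norm_rpow_mul_norm_sq hκ hT hs f)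

lemma integrable_log_norm_mul_norm_sq (hκ : 0 < κ) (hT : ∀ ζ, T (T.adjoint ζ) = κ • ζ)
    (hW : 0 < Module.finrank ℝ W) (f : 𝓢(V, H)) :
    Integrable fun x => Real.log ‖T x‖ * ‖f x‖ ^ 2 :=
  (integrable_withDensity_enorm_sq_iff f).1 <|
    ProbabilityTheory.integrable_of_mem_interior_integrableExpSet <|
      zero_mem_interior_integrableExpSet_log (ae_norm_apply_pos_withDensity hκ.ne' hT hW f)
        (eventually_integrable_norm_rpow_withDensity hκ hT hW f)

lemma hasDerivAt_integral_norm_rpow_mul_norm_sq (hκ : 0 < κ)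
    (hT : ∀ ζ, T (T.adjoint ζ) = κ • ζ) (hW : 0 < Module.finrank ℝ W) (f : 𝓢(V, H)) :
    HasDerivAt (fun s : ℝ => ∫ x, ‖T x‖ ^ s * ‖f x‖ ^ 2) (∫ x, Real.log ‖T x‖ * ‖f x‖ ^ 2) 0 := by
  simp only [← integral_withDensity_enorm_sq]
  exact hasDerivAt_integral_rpow_zero (ae_norm_apply_pos_withDensity hκ.ne' hT hW f)
    (eventually_integrable_norm_rpow_withDensity hκ hT hW f)

theorem log_uncertainty (hκ : 0 < κ) (hT : ∀ ζ, T (T.adjoint ζ) = κ • ζ)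
    (hW : 0 < Module.finrank ℝ W) (f : 𝓢(V, H)) :
    (psi (Module.finrank ℝ W / 4) - Real.log (Real.pi / κ)) * ∫ x, ‖f x‖ ^ 2 ≤
      (∫ x, Real.log ‖T x‖ * ‖f x‖ ^ 2) + ∫ w, Real.log ‖T w‖ * ‖𝓕 f w‖ ^ 2 := by
  have hm : (0 : ℝ) < Module.finrank ℝ W := by exact_mod_cast hW
  have hspace : HasDerivAt (fun s : ℝ => ∫ x, ‖T x‖ ^ (-s) * ‖f x‖ ^ 2)
      ((∫ x, Real.log ‖T x‖ * ‖f x‖ ^ 2) * -1) 0 :=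
    HasDerivAt.comp (0 : ℝ) (h₂ := fun s : ℝ => ∫ x, ‖T x‖ ^ s * ‖f x‖ ^ 2)
      (by simpa using hasDerivAt_integral_norm_rpow_mul_norm_sq hκ hT hW f) (hasDerivAt_neg 0)
  have hgap := ((hasDerivAt_pittConst hm hκ).mul
    (hasDerivAt_integral_norm_rpow_mul_norm_sq hκ hT hW (𝓕 f))).sub hspace
  have hplancherel := f.integral_norm_sq_fourier
  have hnonneg := nonneg_of_hasDerivAt_zero hgap (by simp [pittConst_zero hm, hplancherel]) <| by
    filter_upwards [Ioo_mem_nhdsGT hm] with s hs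
    exact sub_nonneg.2 (integral_pitt hκ hT hs.1 hs.2 f)
  simp only [Real.rpow_zero, one_mul, pittConst_zero hm, hplancherel] at hnonneg
  linarith

end LogUncertainty

section OneSubCos

variable {W : Type*} [NormedAddCommGroup W] [InnerProductSpace ℝ W] [FiniteDimensional ℝ W]
  [MeasurableSpace W] [BorelSpace W]

lemma one_sub_cos_nonneg (θ : ℝ) : 0 ≤ 1 - Real.cos θ := sub_nonneg.2 (Real.cos_le_one θ)

lemma integral_heat_mul_cos {t : ℝ} (ht : 0 < t) (w : W) :
    ∫ v, heat t v * Real.cos (2 * Real.pi * ⟪v, w⟫_ℝ) = Real.exp (-(Real.pi * t * ‖w‖ ^ 2)) := by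
  have hint : Integrable fun v => Real.fourierChar (-⟪v, w⟫_ℝ) • (heat t v : ℂ) :=
    (Real.fourierIntegral_convergent_iff w).2 (integrable_heat ht).ofReal
  have hre := congrArg Complex.re (fourier_heat ht w)
  rw [Real.fourier_eq, Complex.ofReal_re, ← RCLike.re_eq_complex_re, ← integral_re hint] at hre
  rw [← hre]
  congr with v
  rw [Circle.smul_def, Real.fourierChar_apply, smul_eq_mul, RCLike.re_eq_complex_re,
    Complex.re_mul_ofReal, Complex.exp_ofReal_mul_I_re, mul_neg, Real.cos_neg, mul_comm]

lemma lintegral_heat_mul_one_sub_cos {t : ℝ} (ht : 0 < t) (w : W) :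
    ∫⁻ v, ENNReal.ofReal (heat t v * (1 - Real.cos (2 * Real.pi * ⟪v, w⟫_ℝ))) =
      ENNReal.ofReal (1 - Real.exp (-(Real.pi * t * ‖w‖ ^ 2))) := by
  have hcos : Integrable fun v : W => heat t v * Real.cos (2 * Real.pi * ⟪v, w⟫_ℝ) :=
    (integrable_heat ht).mul_bdd (by fun_prop) (.of_forall fun v => Real.abs_cos_le_one _)
  have hmass : ∫ v : W, heat t v = 1 := by simpa using integral_heat_mul_cos ht (0 : W)
  have hint : Integrable fun v : W => heat t v * (1 - Real.cos (2 * Real.pi * ⟪v, w⟫_ℝ)) := by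
    simpa only [mul_sub, mul_one] using! (integrable_heat ht).sub hcos
  rw [← ofReal_integral_eq_lintegral_ofReal hint
    (.of_forall fun v => mul_nonneg (heat_nonneg ht v) (one_sub_cos_nonneg _))]
  simp only [mul_sub, mul_one]
  rw [integral_sub (integrable_heat ht) hcos, hmass, integral_heat_mul_cos ht]

lemma lintegral_gaussian_mul_one_sub_cos {t : ℝ} (ht : 0 < t) (w : W) :
    ∫⁻ v, ENNReal.ofReal (Real.exp (-(Real.pi * ‖v‖ ^ 2 * t))) *
        ENNReal.ofReal (1 - Real.cos (2 * Real.pi * ⟪v, w⟫_ℝ)) =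
      ENNReal.ofReal (t ^ (-(Module.finrank ℝ W / 2 : ℝ)) *
        (1 - Real.exp (-(Real.pi * ‖w‖ ^ 2 / t)))) := by
  have hgauss (v : W) : Real.exp (-(Real.pi * ‖v‖ ^ 2 * t)) =
      t ^ (-(Module.finrank ℝ W / 2 : ℝ)) * heat t⁻¹ v := by
    rw [heat, div_inv_eq_mul, ← mul_assoc, ← Real.mul_rpow ht.le (by positivity),
      mul_inv_cancel₀ ht.ne', Real.one_rpow, one_mul]
  rw [ENNReal.ofReal_mul (by positivity), show Real.pi * ‖w‖ ^ 2 / t = Real.pi * t⁻¹ * ‖w‖ ^ 2 by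
    ring, ← lintegral_heat_mul_one_sub_cos (inv_pos.2 ht), ← lintegral_const_mul' _ _ ofReal_ne_top]
  refine lintegral_congr fun v => ?_
  rw [hgauss, ENNReal.ofReal_mul (by positivity), ENNReal.ofReal_mul
    (heat_nonneg (inv_pos.2 ht) v), mul_assoc]

lemma lintegral_norm_rpow_mul_one_sub_cos {lam : ℝ} (hlam : 0 < lam) (hlam2 : lam < 2) {w : W}
    (hw : w ≠ 0) :
    ∫⁻ v, ENNReal.ofReal (‖v‖ ^ (-(Module.finrank ℝ W + lam))) *
        ENNReal.ofReal (1 - Real.cos (2 * Real.pi * ⟪v, w⟫_ℝ)) =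
      ENNReal.ofReal (2 / lam * Real.pi ^ (Module.finrank ℝ W / 2 + lam) *
        (Real.Gamma (1 - lam / 2) / Real.Gamma ((Module.finrank ℝ W + lam) / 2)) *
          ‖w‖ ^ lam) := by
  have : Nontrivial W := ⟨w, 0, hw⟩
  calc ∫⁻ v, ENNReal.ofReal (‖v‖ ^ (-(Module.finrank ℝ W + lam))) *
        ENNReal.ofReal (1 - Real.cos (2 * Real.pi * ⟪v, w⟫_ℝ))
      = ∫⁻ v, ENNReal.ofReal (Real.pi ^ ((Module.finrank ℝ W + lam) / 2)) *
          ∫⁻ t, ENNReal.ofReal (Real.exp (-(Real.pi * ‖v‖ ^ 2 * t))) *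
            ENNReal.ofReal (1 - Real.cos (2 * Real.pi * ⟪v, w⟫_ℝ))
              ∂liouville ((Module.finrank ℝ W + lam) / 2) := by
        refine lintegral_congr_ae ?_
        filter_upwards [compl_mem_ae_iff.2 (measure_singleton (0 : W))] with v hv
        rw [ofReal_norm_rpow_neg (by positivity) hv, mul_assoc, lintegral_mul_const _ (by fun_prop)]
    _ = ENNReal.ofReal (Real.pi ^ ((Module.finrank ℝ W + lam) / 2)) *
          ∫⁻ t, (∫⁻ v : W, ENNReal.ofReal (Real.exp (-(Real.pi * ‖v‖ ^ 2 * t))) *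
            ENNReal.ofReal (1 - Real.cos (2 * Real.pi * ⟪v, w⟫_ℝ)))
              ∂liouville ((Module.finrank ℝ W + lam) / 2) := by
        rw [lintegral_const_mul' _ _ ofReal_ne_top, lintegral_lintegral_swap (by fun_prop)]
    _ = ENNReal.ofReal (Real.pi ^ ((Module.finrank ℝ W + lam) / 2)) *
          ∫⁻ t, ENNReal.ofReal (t ^ (-(Module.finrank ℝ W / 2 : ℝ)) *
            (1 - Real.exp (-(Real.pi * ‖w‖ ^ 2 / t))))
              ∂liouville ((Module.finrank ℝ W + lam) / 2) := by
        congr 1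
        exact lintegral_congr_ae ((ae_liouville_pos _).mono fun t ht =>
          lintegral_gaussian_mul_one_sub_cos ht w)
    _ = _ := by
        rw [lintegral_rpow_mul_one_sub_exp_liouville (by positivity) (by linarith) (by linarith)
          (by positivity), ← ENNReal.ofReal_mul (by positivity),
          Real.mul_rpow Real.pi_pos.le (by positivity), ← Real.rpow_natCast,
          ← Real.rpow_mul (norm_nonneg w),
          show (Module.finrank ℝ W / 2 : ℝ) + lam =
            (Module.finrank ℝ W + lam) / 2 + lam / 2 by ring, Real.rpow_add Real.pi_pos]
        ring_nf

end OneSubCos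

/-- The constant in front of the difference functional of a linear map `T` onto an
`m`-dimensional space with `T T† = κ`; `constG n` is the case `m = n`, `κ = 2`. -/
def differenceConst (m κ lam : ℝ) : ℝ :=
  (Real.pi / κ) ^ (-m / 2) * (lam / 4) *
    (Real.Gamma ((m + lam) / 2) / Real.Gamma (1 - lam / 2)) *
    (Real.Gamma ((m - lam) / 4) / Real.Gamma ((m + lam) / 4)) ^ 2

lemma differenceConst_pos {m κ lam : ℝ} (hκ : 0 < κ) (hlam : 0 < lam) (hlam2 : lam < 2)
    (hlamm : lam < m) : 0 < differenceConst m κ lam := by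
  have := Real.Gamma_pos_of_pos (show 0 < (m - lam) / 4 by linarith)
  have := Real.Gamma_pos_of_pos (show 0 < (m + lam) / 4 by linarith)
  have := Real.Gamma_pos_of_pos (show 0 < (m + lam) / 2 by linarith)
  have := Real.Gamma_pos_of_pos (show 0 < 1 - lam / 2 by linarith)
  unfold differenceConst
  positivity

lemma differenceConst_mul {m κ lam : ℝ} (hκ : 0 < κ) (hlam : 0 < lam) (hlam2 : lam < 2)
    (hm : 0 < m) :
    differenceConst m κ lam * (√κ ^ (-(m + lam)) * (2 * (2 / lam * Real.pi ^ (m / 2 + lam) *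
      (Real.Gamma (1 - lam / 2) / Real.Gamma ((m + lam) / 2)) * (√κ)⁻¹ ^ lam))) =
        pittConst m κ lam := by
  have := Real.Gamma_pos_of_pos (show 0 < (m + lam) / 2 by linarith)
  have := Real.Gamma_pos_of_pos (show 0 < 1 - lam / 2 by linarith)
  have hsqrt : √κ ^ (-(m + lam)) * (√κ)⁻¹ ^ lam = κ ^ (-m / 2) * (κ ^ lam)⁻¹ := by
    rw [Real.inv_rpow (by positivity), ← Real.rpow_neg (by positivity),
      ← Real.rpow_neg (by positivity), ← Real.rpow_add (by positivity), Real.sqrt_eq_rpow,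
      ← Real.rpow_mul (by positivity), ← Real.rpow_add (by positivity)]
    congr 1
    ring
  have hπ : (Real.pi / κ) ^ (-m / 2) * Real.pi ^ (m / 2 + lam) *
      (√κ ^ (-(m + lam)) * (√κ)⁻¹ ^ lam) = (Real.pi / κ) ^ lam := by
    rw [hsqrt, Real.div_rpow Real.pi_pos.le hκ.le, Real.div_rpow Real.pi_pos.le hκ.le,
      Real.rpow_add Real.pi_pos, neg_div, Real.rpow_neg Real.pi_pos.le]
    field_simp
  rw [pittConst, ← hπ, differenceConst]
  generalize Real.Gamma (1 - lam / 2) = a at *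
  field_simp
  ring

/-- The integrand of the difference functional of a linear map `T : V → W`; `differenceDensity` is
the case `T (x, y) = x - y`. -/
def mapDifferenceDensity {V W H : Type*} [NormedAddCommGroup V] [NormedSpace ℝ V]
    [NormedAddCommGroup W] [NormedSpace ℝ W] [NormedAddCommGroup H] (T : V →L[ℝ] W) (lam : ℝ)
    (f : V → H) (x x' : V) : ℝ :=
  ‖T (x - x')‖ ^ (-(Module.finrank ℝ W : ℝ) - lam) * ‖f x - f x'‖ ^ 2

/-- The affine isometry `s ↦ x + T† s / √κ` of `W` onto the translate of `(ker T)ᗮ` through `x`,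
when `T T† = κ`. -/
def coimagePoint {V W : Type*} [NormedAddCommGroup V] [InnerProductSpace ℝ V] [CompleteSpace V]
    [NormedAddCommGroup W] [InnerProductSpace ℝ W] [CompleteSpace W] (T : V →L[ℝ] W) (κ : ℝ)
    (x : V) (s : W) : V :=
  x + (√κ)⁻¹ • T.adjoint s

section DifferenceFunctional

variable {V W H : Type*} [NormedAddCommGroup V] [InnerProductSpace ℝ V] [NormedAddCommGroup W]
  [InnerProductSpace ℝ W] [NormedAddCommGroup H] {T : V →L[ℝ] W} {κ lam : ℝ}

lemma mapDifferenceDensity_nonneg (T : V →L[ℝ] W) (lam : ℝ) (f : V → H) (x x' : V) :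
    0 ≤ mapDifferenceDensity T lam f x x' := by
  unfold mapDifferenceDensity
  positivity

lemma mapDifferenceDensity_coimagePoint [CompleteSpace V] [CompleteSpace W] (hκ : 0 < κ)
    (hT : ∀ ζ, T (T.adjoint ζ) = κ • ζ) (f : V → H) (x : V) (s : W) :
    mapDifferenceDensity T lam f x (coimagePoint T κ x s) =
      √κ ^ (-(Module.finrank ℝ W + lam)) * ‖s‖ ^ (-(Module.finrank ℝ W + lam)) *
        ‖f x - f (x + (√κ)⁻¹ • T.adjoint s)‖ ^ 2 := by
  have hT' : T (x - coimagePoint T κ x s) = -(√κ • s) := by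
    rw [coimagePoint, sub_add_cancel_left, map_neg, map_smul, hT, smul_smul, inv_mul_eq_div,
      Real.div_sqrt]
  rw [mapDifferenceDensity, hT', norm_neg, norm_smul, Real.norm_of_nonneg (by positivity),
    Real.mul_rpow (by positivity) (norm_nonneg s), neg_add', coimagePoint]

variable [FiniteDimensional ℝ V] [MeasurableSpace V] [BorelSpace V]

lemma measurable_mapDifferenceDensity (T : V →L[ℝ] W) (lam : ℝ) {f : V → H} (hf : Continuous f) :
    Measurable fun q : V × V => mapDifferenceDensity T lam f q.1 q.2 :=
  (Continuous.measurable (by fun_prop)).pow_const _ |>.mul (Continuous.measurable (by fun_prop))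

variable [FiniteDimensional ℝ W] [MeasurableSpace W] [BorelSpace W]

lemma measurable_mapDifferenceDensity_coimagePoint (T : V →L[ℝ] W) (lam : ℝ) {f : V → H}
    (hf : Continuous f) :
    Measurable fun q : V × W => mapDifferenceDensity T lam f q.1 (coimagePoint T κ q.1 q.2) :=
  (measurable_mapDifferenceDensity T lam hf).comp
    (Continuous.measurable (by unfold coimagePoint; fun_prop) :
      Measurable fun q : V × W => (q.1, coimagePoint T κ q.1 q.2))

variable [InnerProductSpace ℂ H] [CompleteSpace H]

lemma lintegral_mapDifferenceDensity_eq_lintegral_cos (hκ : 0 < κ)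
    (hT : ∀ ζ, T (T.adjoint ζ) = κ • ζ) (f : 𝓢(V, H)) :
    ∫⁻ q : V × W, ENNReal.ofReal (mapDifferenceDensity T lam f q.1 (coimagePoint T κ q.1 q.2)) =
      ∫⁻ w, ENNReal.ofReal (√κ ^ (-(Module.finrank ℝ W + lam)) * 2) * ‖𝓕 f w‖ₑ ^ 2 *
        ∫⁻ s, ENNReal.ofReal (‖s‖ ^ (-(Module.finrank ℝ W + lam))) *
          ENNReal.ofReal (1 - Real.cos (2 * Real.pi * ⟪s, (√κ)⁻¹ • T w⟫_ℝ)) := by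
  have hmeas := measurable_mapDifferenceDensity_coimagePoint (κ := κ) T lam f.continuous
  have := (𝓕 f).continuous.enorm.measurable
  have hc : 0 ≤ √κ ^ (-(Module.finrank ℝ W + lam)) := by positivity
  have htranslate (s : W) :
      ∫⁻ x, ENNReal.ofReal (√κ ^ (-(Module.finrank ℝ W + lam)) *
        ‖s‖ ^ (-(Module.finrank ℝ W + lam)) * ‖f x - f (x + (√κ)⁻¹ • T.adjoint s)‖ ^ 2) =
      ∫⁻ w, ENNReal.ofReal (√κ ^ (-(Module.finrank ℝ W + lam)) * 2) * ‖𝓕 f w‖ₑ ^ 2 *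
        (ENNReal.ofReal (‖s‖ ^ (-(Module.finrank ℝ W + lam))) *
          ENNReal.ofReal (1 - Real.cos (2 * Real.pi * ⟪s, (√κ)⁻¹ • T w⟫_ℝ))) := by
    have hcs : 0 ≤ √κ ^ (-(Module.finrank ℝ W + lam)) * ‖s‖ ^ (-(Module.finrank ℝ W + lam)) := by
      positivity
    simp only [ENNReal.ofReal_mul hcs, ← enorm_sq_eq_ofReal]
    rw [lintegral_const_mul' _ _ ofReal_ne_top, lintegral_enorm_sub_translate_sq,
      ← lintegral_const_mul' _ _ ofReal_ne_top]
    refine lintegral_congr fun w => ?_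
    rw [ENNReal.ofReal_mul hc, ENNReal.ofReal_mul hc, ENNReal.ofReal_mul zero_le_two,
      real_inner_smul_left, real_inner_smul_right, ContinuousLinearMap.adjoint_inner_left]
    ring
  rw [Measure.volume_eq_prod, lintegral_prod_symm' _ hmeas.ennreal_ofReal]
  simp only [mapDifferenceDensity_coimagePoint hκ hT, htranslate]
  rw [lintegral_lintegral_swap (by fun_prop)]
  exact lintegral_congr fun w => lintegral_const_mul _ (by fun_prop)

lemma lintegral_mapDifferenceDensity (hκ : 0 < κ) (hT : ∀ ζ, T (T.adjoint ζ) = κ • ζ)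
    (hlam : 0 < lam) (hlam2 : lam < 2) (hlamW : lam < Module.finrank ℝ W) (f : 𝓢(V, H)) :
    ENNReal.ofReal (differenceConst (Module.finrank ℝ W) κ lam) *
        ∫⁻ q : V × W, ENNReal.ofReal
          (mapDifferenceDensity T lam f q.1 (coimagePoint T κ q.1 q.2)) =
      ENNReal.ofReal (pittConst (Module.finrank ℝ W) κ lam) *
        ∫⁻ w, ENNReal.ofReal (‖T w‖ ^ lam) * ‖𝓕 f w‖ₑ ^ 2 := by
  have hT0 := ne_zero_of_apply_adjoint hκ.ne' hT (mod_cast hlam.trans hlamW)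
  have hm := hlam.trans hlamW
  have hG := (differenceConst_pos hκ hlam hlam2 hlamW).le
  rw [lintegral_mapDifferenceDensity_eq_lintegral_cos hκ hT,
    ← lintegral_const_mul' _ _ ofReal_ne_top, ← lintegral_const_mul' _ _ ofReal_ne_top]
  refine lintegral_congr_ae ((ae_apply_ne_zero hT0).mono fun w hw => ?_)
  have hw' : (√κ)⁻¹ • T w ≠ 0 := smul_ne_zero (by positivity) hw
  have := Real.Gamma_pos_of_pos (show 0 < (Module.finrank ℝ W + lam) / 2 by linarith)
  have := Real.Gamma_pos_of_pos (show 0 < 1 - lam / 2 by linarith)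
  beta_reduce
  rw [lintegral_norm_rpow_mul_one_sub_cos hlam hlam2 hw', mul_right_comm (ENNReal.ofReal (_ * 2)),
    ← mul_assoc, ← mul_assoc, ← ENNReal.ofReal_mul (by positivity),
    ← ENNReal.ofReal_mul (by positivity), ← mul_assoc (ENNReal.ofReal (pittConst _ _ _)),
    ← ENNReal.ofReal_mul' (by positivity), ← differenceConst_mul hκ hlam hlam2 hm, norm_smul,
    Real.norm_of_nonneg (by positivity), Real.mul_rpow (by positivity) (norm_nonneg _)]
  ring_nf

lemma integrable_mapDifferenceDensity (hκ : 0 < κ) (hT : ∀ ζ, T (T.adjoint ζ) = κ • ζ)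
    (hlam : 0 < lam) (hlam2 : lam < 2) (hlamW : lam < Module.finrank ℝ W) (f : 𝓢(V, H)) :
    Integrable fun q : V × W => mapDifferenceDensity T lam f q.1 (coimagePoint T κ q.1 q.2) := by
  refine (lintegral_ofReal_ne_top_iff_integrable
    (measurable_mapDifferenceDensity_coimagePoint T lam f.continuous).aestronglyMeasurable
    (.of_forall fun _ => mapDifferenceDensity_nonneg ..)).1 fun htop => ?_
  have hpitt := lintegral_mapDifferenceDensity hκ hT hlam hlam2 hlamW f
  rw [htop, mul_top (ofReal_pos.2 (differenceConst_pos hκ hlam hlam2 hlamW)).ne',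
    lintegral_norm_rpow_mul_enorm_sq] at hpitt
  exact mul_ne_top ofReal_ne_top
    (integrable_norm_rpow_mul_norm_sq_of_nonneg T hlam.le (𝓕 f)).lintegral_lt_top.ne hpitt.symm

theorem integral_norm_rpow_le_integral_mapDifferenceDensity (hκ : 0 < κ)
    (hT : ∀ ζ, T (T.adjoint ζ) = κ • ζ) (hlam : 0 < lam) (hlam2 : lam < 2)
    (hlamW : lam < Module.finrank ℝ W) (f : 𝓢(V, H)) :
    ∫ x, ‖T x‖ ^ (-lam) * ‖f x‖ ^ 2 ≤ differenceConst (Module.finrank ℝ W) κ lam *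
      ∫ q : V × W, mapDifferenceDensity T lam f q.1 (coimagePoint T κ q.1 q.2) := by
  have hG := (differenceConst_pos hκ hlam hlam2 hlamW).le
  have hpitt := lintegral_pitt hκ hT hlam hlamW f
  rw [← lintegral_mapDifferenceDensity hκ hT hlam hlam2 hlamW, lintegral_norm_rpow_mul_enorm_sq,
    ← ofReal_integral_eq_lintegral_ofReal (integrable_norm_rpow_mul_norm_sq hκ hT (by linarith) f)
      (.of_forall fun _ => by positivity),
    ← ofReal_integral_eq_lintegral_ofReal
      (integrable_mapDifferenceDensity hκ hT hlam hlam2 hlamW f)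
      (.of_forall fun _ => mapDifferenceDensity_nonneg ..), ← ENNReal.ofReal_mul hG] at hpitt
  exact (ofReal_le_ofReal_iff (mul_nonneg hG (integral_nonneg fun _ =>
    mapDifferenceDensity_nonneg ..))).1 hpitt

end DifferenceFunctional

section TranslationInvariance

variable {V H : Type*} [NormedAddCommGroup V] [NormedSpace ℝ V] {e : V}

lemma tendsto_add_nsmul_cobounded (he : e ≠ 0) (x : V) :
    Tendsto (fun N : ℕ => x + N • e) atTop (Bornology.cobounded V) := by
  refine (tendsto_const_add_cobounded x).comp (tendsto_norm_atTop_iff_cobounded.1 ?_)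
  simp only [RCLike.norm_nsmul ℝ, nsmul_eq_mul]
  exact tendsto_natCast_atTop_atTop.atTop_mul_const (norm_pos_iff.2 he)

variable [SecondCountableTopology V] [MeasurableSpace V] [BorelSpace V] {μ : Measure V}
  [μ.IsAddRightInvariant] {g : V → ℝ≥0∞}

/-- The measure `μ.withDensity g` is invariant under translation by `e`. If it were finite, Poincaré
recurrence would return some point of a non-null ball of radius `‖e‖ / 2` to that ball, but the
translate by a nonzero multiple of `e` is disjoint from the ball. -/
lemma lintegral_eq_top_of_translate_eq (he : e ≠ 0)
    (hge : ∀ x, g (x + e) = g x) (hg0 : ∫⁻ x, g x ∂μ ≠ 0) : ∫⁻ x, g x ∂μ = ⊤ := by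
  by_contra htop
  have := isFiniteMeasure_withDensity htop
  have hpres : MeasurePreserving (· + e) (μ.withDensity g) (μ.withDensity g) := by
    refine ⟨measurable_add_const e, Measure.ext fun s hs => ?_⟩
    rw [Measure.map_apply (measurable_add_const e) hs, withDensity_apply _ hs,
      withDensity_apply _ (measurable_add_const e hs),
      ← (measurePreserving_add_right μ e).setLIntegral_comp_preimage_emb
        (measurableEmbedding_addRight e) g s]
    simp only [hge]
  have hnull (x : V) : μ.withDensity g (Metric.ball x (‖e‖ / 2)) = 0 := by
    by_contra hball
    obtain ⟨y, hy, m, hm, hmy⟩ := hpres.exists_mem_iterate_mem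
      measurableSet_ball.nullMeasurableSet hball
    rw [add_right_iterate] at hmy
    have hdist : ‖m • e‖ < ‖e‖ := by
      simpa [dist_eq_norm] using (dist_triangle_right (y + m • e) y x).trans_lt
        (add_lt_add hmy hy)
    rw [RCLike.norm_nsmul ℝ, nsmul_eq_mul] at hdist
    have : (1 : ℝ) ≤ m := mod_cast Nat.one_le_iff_ne_zero.2 hm
    nlinarith [norm_nonneg e]
  have hzero : μ.withDensity g univ = 0 := measure_null_of_locally_null _ fun x _ =>
    ⟨_, mem_nhdsWithin_of_mem_nhds (Metric.ball_mem_nhds x (by positivity)), hnull x⟩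
  exact hg0 (by rwa [withDensity_apply _ .univ, setLIntegral_univ] at hzero)

/-- Translating by multiples of `e` pushes `f` away to infinity, so by Fatou's lemma the integral is
at least `‖c‖² ∫ g`. -/
lemma lintegral_mul_enorm_sub_sq_eq_top [NormedAddCommGroup H]
    (he : e ≠ 0) (hg : Measurable g) (hge : ∀ x, g (x + e) = g x) (hg0 : ∫⁻ x, g x ∂μ ≠ 0)
    {f : V → H} (hf : Continuous f) (hf0 : Tendsto f (Bornology.cobounded V) (𝓝 0)) {c : H}
    (hc : c ≠ 0) : ∫⁻ x, g x * ‖c - f x‖ₑ ^ 2 ∂μ = ⊤ := by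
  have hgN (N : ℕ) (x : V) : g (x + N • e) = g x := by
    induction N with
    | zero => simp
    | succ N ih => rw [succ_nsmul, ← add_assoc, hge, ih]
  have hc' : ‖c‖ₑ ^ 2 ≠ 0 := by simpa
  have hlim (x : V) :
      Tendsto (fun N : ℕ => g x * ‖c - f (x + N • e)‖ₑ ^ 2) atTop (𝓝 (g x * ‖c‖ₑ ^ 2)) := by
    refine ENNReal.Tendsto.const_mul ?_ (.inl hc')
    have := (hf0.comp (tendsto_add_nsmul_cobounded he x)).const_sub c
    rw [sub_zero] at this
    exact ((ENNReal.continuous_pow 2).tendsto _).comp this.enorm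
  have htranslate (N : ℕ) :
      ∫⁻ x, g x * ‖c - f (x + N • e)‖ₑ ^ 2 ∂μ = ∫⁻ x, g x * ‖c - f x‖ₑ ^ 2 ∂μ := by
    rw [← lintegral_add_right_eq_self (fun x => g x * ‖c - f x‖ₑ ^ 2) (N • e)]
    simp only [hgN]
  refine top_unique ?_
  calc ⊤ = ∫⁻ x, g x * ‖c‖ₑ ^ 2 ∂μ := by
        rw [lintegral_mul_const _ hg, lintegral_eq_top_of_translate_eq he hge hg0, top_mul hc']
    _ = ∫⁻ x, liminf (fun N : ℕ => g x * ‖c - f (x + N • e)‖ₑ ^ 2) atTop ∂μ :=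
        lintegral_congr fun x => (hlim x).liminf_eq.symm
    _ ≤ liminf (fun N : ℕ => ∫⁻ x, g x * ‖c - f (x + N • e)‖ₑ ^ 2 ∂μ) atTop :=
        lintegral_liminf_le fun N => hg.mul (Continuous.measurable (by fun_prop))
    _ = ∫⁻ x, g x * ‖c - f x‖ₑ ^ 2 ∂μ := by simp only [htranslate, liminf_const]

end TranslationInvariance

section WholeSpace

variable {V W H : Type*} [NormedAddCommGroup V] [InnerProductSpace ℝ V] [FiniteDimensional ℝ V]
  [MeasurableSpace V] [BorelSpace V] [NormedAddCommGroup W] [InnerProductSpace ℝ W]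
  {T : V →L[ℝ] W} {e : V} {κ lam : ℝ}

lemma lintegral_mapDifferenceDensity_eq_top [NormedAddCommGroup H] (hT0 : T ≠ 0) (he : e ≠ 0)
    (hTe : T e = 0) (lam : ℝ) {f : V → H} (hf : Continuous f)
    (hf0 : Tendsto f (Bornology.cobounded V) (𝓝 0)) {x : V} (hx : f x ≠ 0) :
    ∫⁻ x', ENNReal.ofReal (mapDifferenceDensity T lam f x x') = ⊤ := by
  simp only [mapDifferenceDensity, ENNReal.ofReal_mul (Real.rpow_nonneg (norm_nonneg _) _),
    ← enorm_sq_eq_ofReal]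
  have hmeas : Measurable fun x' =>
      ENNReal.ofReal (‖T (x - x')‖ ^ (-(Module.finrank ℝ W : ℝ) - lam)) :=
    ((Continuous.measurable (by fun_prop)).pow_const _).ennreal_ofReal
  refine lintegral_mul_enorm_sub_sq_eq_top he hmeas (fun x' => ?_) ?_ hf hf0 hx
  · rw [← sub_sub, map_sub, hTe, sub_zero]
  · rw [Ne, lintegral_eq_zero_iff hmeas]
    intro hzero
    have hne := (Measure.measurePreserving_sub_left volume x).quasiMeasurePreserving.ae
      (ae_apply_ne_zero hT0)
    obtain ⟨x', hx', hTx'⟩ := (hzero.and hne).exists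
    exact (ENNReal.ofReal_pos.2 (Real.rpow_pos_of_pos (norm_pos_iff.2 hTx') _)).ne' hx'

lemma lintegral_prod_mapDifferenceDensity_eq_top [NormedAddCommGroup H] (hT0 : T ≠ 0)
    (he : e ≠ 0) (hTe : T e = 0) (lam : ℝ) {f : V → H} (hf : Continuous f)
    (hf0 : Tendsto f (Bornology.cobounded V) (𝓝 0)) (hfne : f ≠ 0) :
    ∫⁻ q : V × V, ENNReal.ofReal (mapDifferenceDensity T lam f q.1 q.2) = ⊤ := by
  have hmeas := (measurable_mapDifferenceDensity T lam hf).ennreal_ofReal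
  rw [Measure.volume_eq_prod, lintegral_prod _ hmeas.aemeasurable]
  refine lintegral_eq_top_of_measure_eq_top_ne_zero hmeas.lintegral_prod_right'.aemeasurable
    (ne_bot_of_le_ne_bot ?_ (measure_mono fun x hx =>
      lintegral_mapDifferenceDensity_eq_top hT0 he hTe lam hf hf0 hx))
  exact ((isOpen_ne_fun hf continuous_const).measure_pos volume (Function.ne_iff.1 hfne)).ne'

theorem ofReal_integral_norm_rpow_le_lintegral_mapDifferenceDensity [NormedAddCommGroup H]
    [InnerProductSpace ℂ H] [CompleteSpace H] [FiniteDimensional ℝ W] (hκ : 0 < κ)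
    (hT : ∀ ζ, T (T.adjoint ζ) = κ • ζ) (hinj : ¬ Function.Injective T) (hlam : 0 < lam)
    (hlam2 : lam < 2) (hlamW : lam < Module.finrank ℝ W) (f : 𝓢(V, H)) :
    ENNReal.ofReal (∫ x, ‖T x‖ ^ (-lam) * ‖f x‖ ^ 2) ≤
      ENNReal.ofReal (differenceConst (Module.finrank ℝ W) κ lam) *
        ∫⁻ q : V × V, ENNReal.ofReal (mapDifferenceDensity T lam f q.1 q.2) := by
  obtain hf | hf := eq_or_ne (f : V → H) 0
  · simp [hf]
  obtain ⟨e, hTe, he⟩ : ∃ e, T e = 0 ∧ e ≠ 0 := by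
    simpa [injective_iff_map_eq_zero] using hinj
  have hT0 := ne_zero_of_apply_adjoint hκ.ne' hT (mod_cast hlam.trans hlamW)
  have hf0 : Tendsto f (Bornology.cobounded V) (𝓝 0) := by
    rw [Metric.cobounded_eq_cocompact]
    exact f.tendsto_cocompact
  rw [lintegral_prod_mapDifferenceDensity_eq_top hT0 he hTe lam f.continuous hf0 hf,
    mul_top (ofReal_pos.2 (differenceConst_pos hκ hlam hlam2 hlamW)).ne']
  exact le_top

end WholeSpace

section SubMap

variable {U : Type*} [NormedAddCommGroup U] [InnerProductSpace ℝ U]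

/-- Subtraction `(x, y) ↦ x - y` on the Hilbert sum `U ⊕ U`. -/
def subMap (U : Type*) [NormedAddCommGroup U] [InnerProductSpace ℝ U] :
    WithLp 2 (U × U) →L[ℝ] U :=
  WithLp.fstL 2 ℝ U U - WithLp.sndL 2 ℝ U U

lemma subMap_apply (v : WithLp 2 (U × U)) : subMap U v = v.ofLp.1 - v.ofLp.2 := rfl

lemma not_injective_subMap [Nontrivial U] : ¬ Function.Injective (subMap U) := by
  intro hinj
  obtain ⟨u, hu⟩ := exists_ne (0 : U)
  have hzero : WithLp.toLp 2 (u, u) = 0 := hinj (by simp [subMap_apply])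
  exact hu (congrArg (fun v : WithLp 2 (U × U) => v.fst) hzero)

variable [CompleteSpace U]

lemma adjoint_subMap (ζ : U) : (subMap U).adjoint ζ = WithLp.toLp 2 (ζ, -ζ) := by
  refine ext_inner_right ℝ fun v => ?_
  rw [ContinuousLinearMap.adjoint_inner_left, subMap_apply, WithLp.prod_inner_apply,
    inner_sub_right, inner_neg_left, sub_eq_add_neg]

lemma subMap_adjoint_subMap (ζ : U) : subMap U ((subMap U).adjoint ζ) = (2 : ℝ) • ζ := by
  rw [adjoint_subMap, subMap_apply, sub_neg_eq_add, two_smul]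

end SubMap

lemma pittConst_two (n : ℕ) (lam : ℝ) : pittConst n 2 lam = constF n lam := rfl

lemma differenceConst_two (n : ℕ) (lam : ℝ) : differenceConst n 2 lam = constG n lam := rfl

section EuclideanProduct

variable {n : ℕ}

lemma measurePreserving_toLp_symm :
    MeasurePreserving (MeasurableEquiv.toLp 2 (E n × E n)).symm :=
  WithLp.volume_preserving_ofLp (E n) (E n)

lemma integral_withLp {G : Type*} [NormedAddCommGroup G] [NormedSpace ℝ G] (g : E n × E n → G) :
    ∫ v : WithLp 2 (E n × E n), g v.ofLp = ∫ z, g z :=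
  measurePreserving_toLp_symm.integral_comp' g

lemma integrable_withLp {g : E n × E n → ℝ} :
    (Integrable fun v : WithLp 2 (E n × E n) => g v.ofLp) ↔ Integrable g :=
  measurePreserving_toLp_symm.integrable_comp_emb (MeasurableEquiv.measurableEmbedding _)

lemma measurePreserving_toLp_symm_prod_refl :
    MeasurePreserving ((MeasurableEquiv.toLp 2 (E n × E n)).symm.prodCongr (.refl (E n))) :=
  measurePreserving_toLp_symm.prod (.id volume)

lemma integral_withLp_prod (g : (E n × E n) × E n → ℝ) :
    ∫ q : WithLp 2 (E n × E n) × E n, g (q.1.ofLp, q.2) = ∫ q, g q :=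
  measurePreserving_toLp_symm_prod_refl.integral_comp' g

lemma integrable_withLp_prod {g : (E n × E n) × E n → ℝ} :
    (Integrable fun q : WithLp 2 (E n × E n) × E n => g (q.1.ofLp, q.2)) ↔ Integrable g :=
  measurePreserving_toLp_symm_prod_refl.integrable_comp_emb (MeasurableEquiv.measurableEmbedding _)

lemma lintegral_withLp_prod_withLp (g : (E n × E n) × (E n × E n) → ℝ≥0∞) :
    ∫⁻ q : WithLp 2 (E n × E n) × WithLp 2 (E n × E n), g (q.1.ofLp, q.2.ofLp) = ∫⁻ q, g q :=
  (measurePreserving_toLp_symm.prod measurePreserving_toLp_symm).lintegral_comp_emb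
    (MeasurableEquiv.prodCongr (MeasurableEquiv.toLp 2 _).symm
      (MeasurableEquiv.toLp 2 _).symm).measurableEmbedding g

/-- The complex conjugate of `f`, transported to the Hilbert sum. Conjugation turns the kernel
`e^{2πi ⟨·,·⟩}` of `fourier` into the kernel `e^{-2πi ⟨·,·⟩}` of `𝓕`. -/
def conjWithLp (f : 𝓢(E n × E n, ℂ)) : 𝓢(WithLp 2 (E n × E n), ℂ) :=
  (SchwartzMap.compCLMOfContinuousLinearEquiv ℝ
    (WithLp.prodContinuousLinearEquiv 2 ℝ (E n) (E n)) f).postcompCLM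
      (Complex.conjCLE : ℂ →L[ℝ] ℂ)

lemma conjWithLp_apply (f : 𝓢(E n × E n, ℂ)) (v : WithLp 2 (E n × E n)) :
    conjWithLp f v = starRingEnd ℂ (f v.ofLp) := rfl

lemma fourier_conjWithLp (f : 𝓢(E n × E n, ℂ)) (w : WithLp 2 (E n × E n)) :
    𝓕 (conjWithLp f) w = starRingEnd ℂ (fourier f w.ofLp) := by
  rw [fourier, ← integral_conj, ← integral_withLp, SchwartzMap.fourier_coe, Real.fourier_eq']
  refine integral_congr_ae (.of_forall fun v => ?_)
  simp only [conjWithLp_apply, map_mul, ← Complex.exp_conj, smul_eq_mul, WithLp.prod_inner_apply]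
  congr 2
  simp only [map_ofNat, Complex.conj_ofReal, Complex.conj_I]
  push_cast
  ring

lemma norm_conjWithLp (f : 𝓢(E n × E n, ℂ)) (v : WithLp 2 (E n × E n)) :
    ‖conjWithLp f v‖ = ‖f v.ofLp‖ := by
  rw [conjWithLp_apply, Complex.norm_conj]

lemma norm_fourier_conjWithLp (f : 𝓢(E n × E n, ℂ)) (w : WithLp 2 (E n × E n)) :
    ‖𝓕 (conjWithLp f) w‖ = ‖fourier f w.ofLp‖ := by
  rw [fourier_conjWithLp, Complex.norm_conj]

lemma mapDifferenceDensity_subMap (lam : ℝ) (f : 𝓢(E n × E n, ℂ))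
    (v v' : WithLp 2 (E n × E n)) :
    mapDifferenceDensity (subMap (E n)) lam (conjWithLp f) v v' =
      differenceDensity lam f v.ofLp v'.ofLp := by
  rw [mapDifferenceDensity, differenceDensity, finrank_euclideanSpace_fin, map_sub, subMap_apply,
    subMap_apply, conjWithLp_apply, conjWithLp_apply, ← map_sub, Complex.norm_conj,
    ← sub_add]

lemma ofLp_coimagePoint_subMap (v : WithLp 2 (E n × E n)) (s : E n) :
    (coimagePoint (subMap (E n)) 2 v s).ofLp = planePoint v.ofLp s := by
  rw [coimagePoint, adjoint_subMap, planePoint, sub_eq_add_neg, ← smul_neg]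
  rfl

end EuclideanProduct

end

end PittAS

open PittAS Module
open scoped FourierTransform

theorem mainTheorem10_general {V W H : Type*} [NormedAddCommGroup V] [InnerProductSpace ℝ V]
    [FiniteDimensional ℝ V] [MeasurableSpace V] [BorelSpace V] [NormedAddCommGroup W]
    [InnerProductSpace ℝ W] [FiniteDimensional ℝ W] [MeasurableSpace W] [BorelSpace W]
    [NormedAddCommGroup H] [InnerProductSpace ℂ H] [CompleteSpace H] {T : V →L[ℝ] W} {κ : ℝ}
    (hκ : 0 < κ) (hT : ∀ ζ, T (T.adjoint ζ) = κ • ζ) (hW : 0 < finrank ℝ W) (f : 𝓢(V, H)) :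
    (∀ lam : ℝ, 0 < lam → lam < finrank ℝ W →
      Integrable (fun x => ‖T x‖ ^ (-lam) * ‖f x‖ ^ 2) ∧
      Integrable (fun w => ‖T w‖ ^ lam * ‖𝓕 f w‖ ^ 2) ∧
      ∫ x, ‖T x‖ ^ (-lam) * ‖f x‖ ^ 2 ≤
        pittConst (finrank ℝ W) κ lam * ∫ w, ‖T w‖ ^ lam * ‖𝓕 f w‖ ^ 2) ∧
    (∀ lam : ℝ, 0 < lam → lam < min 2 (finrank ℝ W : ℝ) →
      Integrable (fun q : V × W => mapDifferenceDensity T lam f q.1 (coimagePoint T κ q.1 q.2)) ∧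
      ∫ x, ‖T x‖ ^ (-lam) * ‖f x‖ ^ 2 ≤ differenceConst (finrank ℝ W) κ lam *
        ∫ q : V × W, mapDifferenceDensity T lam f q.1 (coimagePoint T κ q.1 q.2) ∧
      (¬ Function.Injective T →
        ENNReal.ofReal (∫ x, ‖T x‖ ^ (-lam) * ‖f x‖ ^ 2) ≤
          ENNReal.ofReal (differenceConst (finrank ℝ W) κ lam) *
            ∫⁻ q : V × V, ENNReal.ofReal (mapDifferenceDensity T lam f q.1 q.2))) ∧
    (Integrable (fun x => Real.log ‖T x‖ * ‖f x‖ ^ 2) ∧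
      Integrable (fun w => Real.log ‖T w‖ * ‖𝓕 f w‖ ^ 2) ∧
      (psi (finrank ℝ W / 4) - Real.log (Real.pi / κ)) * ∫ x, ‖f x‖ ^ 2 ≤
        (∫ x, Real.log ‖T x‖ * ‖f x‖ ^ 2) + ∫ w, Real.log ‖T w‖ * ‖𝓕 f w‖ ^ 2) := by
  refine ⟨fun lam hlam hlamW => ⟨integrable_norm_rpow_mul_norm_sq hκ hT (by linarith) f,
    integrable_norm_rpow_mul_norm_sq_of_nonneg T hlam.le (𝓕 f),
    integral_pitt hκ hT hlam hlamW f⟩, fun lam hlam hlam' => ?_,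
    integrable_log_norm_mul_norm_sq hκ hT hW f, integrable_log_norm_mul_norm_sq hκ hT hW (𝓕 f),
    log_uncertainty hκ hT hW f⟩
  obtain ⟨hlam2, hlamW⟩ := lt_min_iff.1 hlam'
  exact ⟨integrable_mapDifferenceDensity hκ hT hlam hlam2 hlamW f,
    integral_norm_rpow_le_integral_mapDifferenceDensity hκ hT hlam hlam2 hlamW f, fun hinj =>
    ofReal_integral_norm_rpow_le_lintegral_mapDifferenceDensity hκ hT hinj hlam hlam2 hlamW f⟩

theorem mainTheorem10 (n : ℕ) (hn : 1 ≤ n) (f : 𝓢(PittAS.E n × PittAS.E n, ℂ)) :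
    -- Pitt's inequality for the difference variable
    (∀ lam : ℝ, 0 < lam → lam < n →
      Integrable (PittAS.potentialDensity lam f) ∧
      Integrable (PittAS.frequencyDensity lam f) ∧
      ∫ z, PittAS.potentialDensity lam f z ≤
        PittAS.constF n lam * ∫ w, PittAS.frequencyDensity lam f w) ∧
    -- the form with the nonlocal difference functional
    (∀ lam : ℝ, 0 < lam → lam < min 2 (n : ℝ) →
      Integrable (fun q : (PittAS.E n × PittAS.E n) × PittAS.E n =>
        PittAS.differenceDensity lam f q.1 (PittAS.planePoint q.1 q.2)) ∧
      ∫ z, PittAS.potentialDensity lam f z ≤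
        PittAS.constG n lam *
          ∫ q : (PittAS.E n × PittAS.E n) × PittAS.E n,
            PittAS.differenceDensity lam f q.1 (PittAS.planePoint q.1 q.2) ∧
      ENNReal.ofReal (∫ z, PittAS.potentialDensity lam f z) ≤
        ENNReal.ofReal (PittAS.constG n lam) *
          ∫⁻ q : (PittAS.E n × PittAS.E n) × (PittAS.E n × PittAS.E n),
            ENNReal.ofReal (PittAS.differenceDensity lam f q.1 q.2)) ∧
    -- the logarithmic uncertainty inequality
    (Integrable (fun z : PittAS.E n × PittAS.E n =>
        Real.log ‖z.1 - z.2‖ * ‖f z‖ ^ 2) ∧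
      Integrable (fun w : PittAS.E n × PittAS.E n =>
        Real.log ‖w.1 - w.2‖ * ‖PittAS.fourier f w‖ ^ 2) ∧
      (PittAS.psi ((n : ℝ) / 4) - Real.log (Real.pi / 2)) * ∫ z, ‖f z‖ ^ 2 ≤
        (∫ z : PittAS.E n × PittAS.E n, Real.log ‖z.1 - z.2‖ * ‖f z‖ ^ 2) +
        ∫ w : PittAS.E n × PittAS.E n,
          Real.log ‖w.1 - w.2‖ * ‖PittAS.fourier f w‖ ^ 2) := by
  have hfinrank : 0 < finrank ℝ (E n) := by rwa [finrank_euclideanSpace_fin]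
  have := nontrivial_of_finrank_pos hfinrank
  have hgeneral := mainTheorem10_general two_pos (subMap_adjoint_subMap (U := E n)) hfinrank
    (conjWithLp f)
  simpa only [finrank_euclideanSpace_fin, pittConst_two, differenceConst_two, subMap_apply,
    norm_conjWithLp, norm_fourier_conjWithLp, mapDifferenceDensity_subMap, ofLp_coimagePoint_subMap,
    not_injective_subMap, not_false_eq_true, forall_const, potentialDensity, frequencyDensity,
    ← integral_withLp, ← integrable_withLp, ← integral_withLp_prod, ← integrable_withLp_prod,
    ← lintegral_withLp_prod_withLp] using hgeneral
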